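/- **Setting.** There are $K\ge 1$ arms. At each time $t\ge1$ arm $i$ produces a reward $Y_{i,t}\in[0,1]$; the rewards of each arm are i.i.d. over time with mean $\mu_i$, and rewards at different times are independent. Arm $1$ is the unique best arm, and $\Delta_i=\mu_1-\mu_i>0$ for $i\ge2$. Let $A_t$ be the arm played at time $t$. *Cycles.* The first cycle starts at time $1$; each cycle ends at the first time at which the played arm differs from the first arm of the cycle, and the next cycle starts one step later. Let $M_i(t)$ be the number of times $s\le t$ that are the first or the last step of a cycle and satisfy $A_s=i$, and let $S_i(t)$ be the sum of the rewards $Y_{i,s}$ over these times $s$. *Batched Thompson sampling* with batch growth factor $\alpha>1$ and Gaussian variance $\sigma^2>0$. Put $T_0=0$. The $(j+1)$-st batch ends at the first time $T_{j+1}>T_j$ that is the end of a cycle and at which $M_i(T_{j+1})=\max\{1,\lceil\alpha M_i(T_j)\rceil\}$ for some arm $i$ ($T_{j+1}=\infty$ if this never happens). At each time $t$ in the $(j+1)$-st batch, given the past, independent samples $\theta_i(t)\sim\mathcal N\big(\tfrac{S_i(T_j)}{1+M_i(T_j)},\tfrac{\sigma^2}{1+M_i(T_j)}\big)$ are drawn,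 and $A_t\in\arg\max_i\theta_i(t)$ is played. The batch complexity is $B(T)=\min\{j\ge1: T\le T_j\}$. **Theorem.** There is an absolute constant $C>0$ (independent of $K$, $T$, $\alpha$, $\sigma$ and the reward distributions) such that, whenever $T\ge2$ and $1<\alpha\le\frac{5\sigma^2}{4}$, the following hold. 1. If $T\ge K$, then, on every realization, $$B(T)\le 1+K+K\log_\alpha\Big(\frac TK\Big).$$ 2. In expectation, $$\mathbb E[B(T)]\le 1+K+\log_\alpha\Big(1+C\alpha\sigma^2\sum_{i=2}^K\frac{\log T}{\Delta_i^2}\Big)+\sum_{i=2}^K\log_\alpha\Big(1+C\alpha\sigma^2\frac{\log T}{\Delta_i^2}\Big).$$ 3. In expectation, $$\mathbb E[B(T)]\le 1+2C\alpha\sigma^2\sum_{i=2}^K\frac{\log T}{\Delta_i^2}.$$ Moreover $\mathbb E[B(T)]=O(K\log\log T)$ as $T\to\infty$: for all $\alpha,\sigma,\delta>0$ with $1<\alpha\le\frac{5\sigma^2}{4}$ there are constants $c$ and $T_0$, depending only on $\alpha$, $\sigma$ and $\delta$, such that $\mathbb E[B(T)]\le c\,K\log\log T$ for all $K$, all reward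 distributions with $\Delta_i\ge\delta$ for every $i\ge2$, and all $T\ge T_0$. -/

import Mathlib

open MeasureTheory ProbabilityTheory

universe u

noncomputable section

namespace BatchedTS

/-! Time steps are `1, 2, 3, …`; the value of a sequence at time `0` is never used.
The arms are the elements of `Fin K`; the element `0` is the optimal arm.
`a t` is the arm played at time `t`, and `y i t` is the reward that arm `i` produces at time `t`. -/

/-- `cycleEnd a k` is the last time step of the `k`-th cycle (`k ≥ 1`): the first time `t`, strictly
after the first step `cycleEnd a (k - 1) + 1` of that cycle, at which the played arm changes. It is
`⊤` if the cycle never ends. By convention `cycleEnd a 0 = 0`. -/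
def cycleEnd {K : ℕ} (a : ℕ → Fin K) : ℕ → ℕ∞
  | 0 => 0
  | k + 1 => sInf {t : ℕ∞ | ∃ n : ℕ, t = n ∧ cycleEnd a k + 1 < t ∧ a n ≠ a (n - 1)}

/-- The first time step of the `k`-th cycle, `k ≥ 1`. -/
def cycleBegin {K : ℕ} (a : ℕ → Fin K) (k : ℕ) : ℕ∞ := cycleEnd a (k - 1) + 1

/-- The time step `t` is the last one of some cycle. -/
def IsCycleEnd {K : ℕ} (a : ℕ → Fin K) (t : ℕ) : Prop :=
  ∃ k : ℕ, 1 ≤ k ∧ (t : ℕ∞) = cycleEnd a k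

/-- The time step `t` is the first one or the last one of some cycle. -/
def IsCycleEndpoint {K : ℕ} (a : ℕ → Fin K) (t : ℕ) : Prop :=
  ∃ k : ℕ, 1 ≤ k ∧ ((t : ℕ∞) = cycleBegin a k ∨ (t : ℕ∞) = cycleEnd a k)

open Classical in
/-- The cycle count `M_i(t)`. -/
def cycleCount {K : ℕ} (a : ℕ → Fin K) (i : Fin K) (t : ℕ) : ℕ :=
  ∑ s ∈ Finset.Icc 1 t, if a s = i ∧ IsCycleEndpoint a s then 1 else 0

open Classical in
/-- `S_i(t)`: the sum of the rewards of arm `i` over the time steps counted by `M_i(t)`. -/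
def rewardSum {K : ℕ} (a : ℕ → Fin K) (y : Fin K → ℕ → ℝ) (i : Fin K) (t : ℕ) : ℝ :=
  ∑ s ∈ Finset.Icc 1 t, if a s = i ∧ IsCycleEndpoint a s then y i s else 0

/-- The upper limit `max {1, ⌈α M_i(t)⌉}` for the cycle count of arm `i` that is set when a batch
ends at time `t` (or at the start, `t = 0`). -/
def upperLimit {K : ℕ} (α : ℝ) (a : ℕ → Fin K) (i : Fin K) (t : ℕ) : ℕ :=
  max 1 ⌈α * (cycleCount a i t : ℝ)⌉₊

/-- The batch end points `T_0 = 0 < T_1 < T_2 < ⋯`: the `(j+1)`-st batch ends at the first end of a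
cycle after `T_j` at which the cycle count of some arm equals the upper limit set at time `T_j`.
The value is `⊤` if the batch never ends (or never starts). -/
def batchEnd {K : ℕ} (α : ℝ) (a : ℕ → Fin K) : ℕ → ℕ∞
  | 0 => 0
  | j + 1 => sInf {t : ℕ∞ | ∃ n : ℕ, t = n ∧ batchEnd α a j < t ∧ IsCycleEnd a n ∧
      ∃ i : Fin K, cycleCount a i n = upperLimit α a i (batchEnd α a j).toNat}

/-- `b(t) = max {j ≥ 0 | T_j ≤ t - 1}`, the number of batches completed before time `t ≥ 1`. -/
def lastBatch {K : ℕ} (α : ℝ) (a : ℕ → Fin K) (t : ℕ) : ℕ :=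
  sSup {j : ℕ | batchEnd α a j ≤ ((t - 1 : ℕ) : ℕ∞)}

/-- `T_{b(t)}`, the last batch end point before time `t ≥ 1`. -/
def lastBatchEnd {K : ℕ} (α : ℝ) (a : ℕ → Fin K) (t : ℕ) : ℕ :=
  (batchEnd α a (lastBatch α a t)).toNat

/-- The batch complexity `B(t) = min {j ≥ 1 | t ≤ T_j}`, the index of the batch that contains the
time step `t`. -/
def batchIndex {K : ℕ} (α : ℝ) (a : ℕ → Fin K) (t : ℕ) : ℕ :=
  sInf {j : ℕ | 1 ≤ j ∧ (t : ℕ∞) ≤ batchEnd α a j}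

/-- The sample `θ_i(t)`, obtained from a standard normal variable `z` by scaling it to the mean
`S_i(T_{b(t)}) / (1 + M_i(T_{b(t)}))` and the variance `σ² / (1 + M_i(T_{b(t)}))`. -/
def sample {K : ℕ} (α σ : ℝ) (a : ℕ → Fin K) (y : Fin K → ℕ → ℝ) (i : Fin K) (t : ℕ) (z : ℝ) : ℝ :=
  rewardSum a y i (lastBatchEnd α a t) / (1 + (cycleCount a i (lastBatchEnd α a t) : ℝ)) +
    √(σ ^ 2 / (1 + (cycleCount a i (lastBatchEnd α a t) : ℝ))) * z

/-- The mean reward `μ_i` of arm `i`. -/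
def meanReward {Ω : Type u} [MeasurableSpace Ω] {K : ℕ} (P : Measure Ω) (Y : Fin K → ℕ → Ω → ℝ)
    (i : Fin K) : ℝ :=
  ∫ ω, Y i 1 ω ∂P

/-- The gap `Δ_i = μ_1 - μ_i`. -/
def gap {Ω : Type u} [MeasurableSpace Ω] {K : ℕ} [NeZero K] (P : Measure Ω)
    (Y : Fin K → ℕ → Ω → ℝ) (i : Fin K) : ℝ :=
  meanReward P Y 0 - meanReward P Y i

/-- A stochastic bandit: `Y i t` is the reward of arm `i` at time `t`. The rewards lie in `[0, 1]`,
those of each arm are identically distributed, those at different times are independent, and arm `0`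
is the unique optimal one. (Rewards of different arms at the same time may be dependent: at most
one of them is ever observed.) -/
structure IsBandit {Ω : Type u} [MeasurableSpace Ω] {K : ℕ} [NeZero K] (P : Measure Ω)
    (Y : Fin K → ℕ → Ω → ℝ) : Prop where
  measurable : ∀ i t, 1 ≤ t → Measurable (Y i t)
  mem_Icc : ∀ i t, 1 ≤ t → ∀ᵐ ω ∂P, Y i t ω ∈ Set.Icc (0 : ℝ) 1
  identDistrib : ∀ i t, 1 ≤ t → IdentDistrib (Y i t) (Y i 1) P P
  indep : iIndepFun (fun (t : ℕ) (ω : Ω) (i : Fin K) => Y i (t + 1) ω) P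
  gap_pos : ∀ i, i ≠ 0 → 0 < gap P Y i

/-- The process `A` of played arms follows Batched Thompson sampling with batch growth factor `α`
and Gaussian variance `σ²` on the bandit `Y`: the internal randomness consists of independent
standard normal variables `Z i t`, independent of the rewards, and at each time the agent plays an
arm whose sample `θ_i(t)` is maximal (ties may be broken in any measurable way). -/
structure IsBatchedThompsonSampling {Ω : Type u} [MeasurableSpace Ω] {K : ℕ} (P : Measure Ω)
    (α σ : ℝ) (Y Z : Fin K → ℕ → Ω → ℝ) (A : ℕ → Ω → Fin K) : Prop where
  measurable_noise : ∀ i t, 1 ≤ t → Measurable (Z i t)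
  map_noise : ∀ i t, 1 ≤ t → P.map (Z i t) = gaussianReal 0 1
  indep_noise : iIndepFun (fun (p : Fin K × ℕ) (ω : Ω) => Z p.1 (p.2 + 1) ω) P
  indep_rewards : IndepFun (fun (ω : Ω) (p : Fin K × ℕ) => Y p.1 (p.2 + 1) ω)
    (fun (ω : Ω) (p : Fin K × ℕ) => Z p.1 (p.2 + 1) ω) P
  measurable_arm : ∀ t, 1 ≤ t → Measurable (A t)
  arm_isMax : ∀ ω t, 1 ≤ t → ∀ i,
    sample α σ (fun s => A s ω) (fun l s => Y l s ω) i t (Z i t ω) ≤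
      sample α σ (fun s => A s ω) (fun l s => Y l s ω) (A t ω) t (Z (A t ω) t ω)

end BatchedTS

end

/-!
The proof has a deterministic and a probabilistic part.

**Paths.** A cycle contributes at most one counted step to each arm, so a cycle count never jumps
over its upper limit, and during a batch that began at time `τ` one has `M_i ≤ α M_i(τ) + 1`
(`cycleCount_le`). Every completed batch is charged to an arm whose limit was reached. If the arm
`i` is charged `n_i` times, then `n_i ≤ M_i` and `n_i ≤ 1 + log_α M_i` (`exists_batchIndex_le`).
The total of the cycle counts is at most `T`, and concavity in the `M_i` gives the pathwise bound.
Moreover the optimal arm is counted at most as often as all other arms together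
(`cycleCount_le_sum_erase`), so that the bounds in expectation follow, by Jensen's inequality,
from `E M_i(T) ≤ C α σ² log T / Δ_i²` for the suboptimal arms (`lintegral_cycleCount_le`).

**Expected cycle counts.** The arms are adapted to the rewards and the noise, up to null sets,
because the samples have no ties (`measurable_arm_nullExtension`). Since the counted steps are
chosen before their rewards are drawn, `exp (l (S_i - μ_i M_i) - l² M_i / 8)` is a
supermartingale, and Ville's inequality controls the empirical means at all times at once
(`measure_exists_le_exponent`). Put `L = 64 σ² log T / Δ_i²`, and let `y` be the midpoint of `μ_1`
and `μ_i`. Counted steps of the arm `i` in batches that began with `M_i < L` number at most `α L +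
1`. So do cycles that begin with the optimal arm in batches that began with `M_1 < L`. Outside of
events of probability `O(1 / T)`, at any other counted step of the arm `i` all samples are at most
`y`, the batch began with `M_1 < L`, and the optimal arm would have been counted if it had been
played (`counted_step_cases`). Let `p` be the conditional probability that the sample of the
optimal arm exceeds `y`. As that sample is independent of the other ones, such a step costs at
most `1 / p` counted steps of the optimal arm in expectation (`measure_explorationEvent_le`). When
the optimal arm is counted for the `n`-th time, the batch began with `k ≥ n / α - 1` counts. There
`1 / p` is of order `exp (D² / n)`, where `D` is the deficit of the counted rewards of the optimal
arm; here the assumption `α ≤ 5 σ² / 4` enters (`inv_gaussianReal_Ioi_le`). By Ville's inequality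
the supremum of `D` over all times with at most `n` counts has the tail `exp (-2 u² / n)`, so that
`exp (D² / n)` has bounded expectation (`lintegral_deficitWeight_le`). Summing over `n ≤ α L + 1`
gives the claim.
-/

noncomputable section

namespace BatchedTS

section Paths

variable {K : ℕ} {a a' : ℕ → Fin K} {α : ℝ}

/-! ### Cycles -/

lemma sInf_coe_eq_coe_iff {q : ℕ∞ → ℕ → Prop} {n : ℕ} :
    sInf {t : ℕ∞ | ∃ n : ℕ, t = n ∧ q t n} = (n : ℕ∞) ↔ q n n ∧ ∀ m < n, ¬ q m m := by
  constructor
  · intro h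
    have hne : {t : ℕ∞ | ∃ n : ℕ, t = n ∧ q t n}.Nonempty := by
      by_contra hc
      rw [Set.not_nonempty_iff_eq_empty] at hc
      simp [hc] at h
    have hmem := csInf_mem hne
    rw [h] at hmem
    obtain ⟨n', hn', hq⟩ := hmem
    have hn'' : n = n' := by exact_mod_cast hn'
    subst hn''
    refine ⟨hq, fun m hm hqm => ?_⟩
    have : sInf {t : ℕ∞ | ∃ n : ℕ, t = n ∧ q t n} ≤ m := sInf_le ⟨m, rfl, hqm⟩
    rw [h] at this
    have : n ≤ m := by exact_mod_cast this
    omega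
  · rintro ⟨hq, hmin⟩
    refine le_antisymm (sInf_le ⟨n, rfl, hq⟩) (le_sInf ?_)
    rintro _ ⟨m, rfl, hm⟩
    by_contra hlt
    exact hmin m (by exact_mod_cast not_le.1 hlt) hm

lemma cycleEnd_succ_eq_coe_iff {k n : ℕ} :
    cycleEnd a (k + 1) = (n : ℕ∞) ↔
      (cycleEnd a k + 1 < n ∧ a n ≠ a (n - 1)) ∧
        ∀ m < n, ¬ (cycleEnd a k + 1 < m ∧ a m ≠ a (m - 1)) :=
  sInf_coe_eq_coe_iff (q := fun t n => cycleEnd a k + 1 < t ∧ a n ≠ a (n - 1))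

lemma cycleEnd_add_one_le (k : ℕ) : cycleEnd a k + 1 ≤ cycleEnd a (k + 1) :=
  le_sInf fun _ ⟨_, _, h, _⟩ => h.le

lemma cycleEnd_mono : Monotone (cycleEnd a) :=
  monotone_nat_of_le_succ fun k => le_self_add.trans (cycleEnd_add_one_le k)

lemma natCast_le_cycleEnd (k : ℕ) : (k : ℕ∞) ≤ cycleEnd a k := by
  induction k with
  | zero => simp
  | succ k ih =>
    refine le_trans ?_ (cycleEnd_add_one_le k)
    push_cast
    gcongr

/-- The time `t` separates two cycles: it is `0` or the last step of a cycle. -/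
def IsBoundary (a : ℕ → Fin K) (t : ℕ) : Prop := ∃ k, (t : ℕ∞) = cycleEnd a k

lemma isBoundary_zero : IsBoundary a 0 := ⟨0, rfl⟩

/-- The local rule behind the cycles: a cycle ends at `t + 1` exactly when `t` lies inside it and
the arm changes. -/
lemma isBoundary_succ {t : ℕ} : IsBoundary a (t + 1) ↔ ¬ IsBoundary a t ∧ a (t + 1) ≠ a t := by
  constructor
  · rintro ⟨_ | k, hk⟩
    · exact absurd hk (by simp [cycleEnd])
    · have hk' := cycleEnd_succ_eq_coe_iff.1 hk.symm
      refine ⟨?_, by simpa using hk'.1.2⟩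
      rintro ⟨j, hj⟩
      have h1 := hk'.1.1
      push_cast at h1
      have h1' : cycleEnd a k < t := lt_of_add_lt_add_right h1
      rcases le_or_gt j k with hjk | hjk
      · exact absurd (hj.trans_le (cycleEnd_mono hjk)) (not_le.2 h1')
      · have h2 := cycleEnd_mono (a := a) (Nat.succ_le_of_lt hjk)
        rw [← hj, Nat.succ_eq_add_one, ← hk] at h2
        have : t + 1 ≤ t := by exact_mod_cast h2
        omega
  · rintro ⟨ht, ha⟩
    have hex : ∃ k, cycleEnd a k ≤ t ∧ ¬ cycleEnd a (k + 1) ≤ t := by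
      by_contra! hc
      have hall : ∀ k, cycleEnd a k ≤ t := by
        intro k
        induction k with
        | zero => simp [cycleEnd]
        | succ k ih => exact hc k ih
      have := (natCast_le_cycleEnd (a := a) (t + 1)).trans (hall (t + 1))
      have : t + 1 ≤ t := by exact_mod_cast this
      omega
    obtain ⟨k, hk, hk'⟩ := hex
    have hlt : cycleEnd a k < t := lt_of_le_of_ne hk fun h => ht ⟨k, h.symm⟩
    refine ⟨k + 1, le_antisymm ?_ (sInf_le ⟨t + 1, rfl, ?_, by simpa using ha⟩)⟩
    · push_cast
      exact Order.add_one_le_of_lt (not_le.1 hk')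
    · push_cast
      exact (ENat.add_lt_add_iff_right (by simp)).2 hlt

lemma isCycleEnd_iff {t : ℕ} : IsCycleEnd a t ↔ 1 ≤ t ∧ IsBoundary a t := by
  constructor
  · rintro ⟨k, hk, h⟩
    refine ⟨?_, k, h⟩
    have := natCast_le_cycleEnd (a := a) k
    rw [← h] at this
    have : k ≤ t := by exact_mod_cast this
    omega
  · rintro ⟨ht, k, h⟩
    refine ⟨k, ?_, h⟩
    rcases Nat.eq_zero_or_pos k with rfl | hk
    · simp only [cycleEnd, Nat.cast_eq_zero] at h
      omega
    · exact hk

lemma isCycleEndpoint_succ_iff {t : ℕ} :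
    IsCycleEndpoint a (t + 1) ↔ IsBoundary a (t + 1) ∨ IsBoundary a t := by
  constructor
  · rintro ⟨k, -, h | h⟩
    · refine Or.inr ⟨k - 1, ?_⟩
      have h : (t : ℕ∞) + 1 = cycleEnd a (k - 1) + 1 := by exact_mod_cast h
      exact ENat.add_left_injective_of_ne_top ENat.one_ne_top h
    · exact Or.inl ⟨k, h⟩
  · rintro (h | ⟨k, h⟩)
    · obtain ⟨k, hk, h⟩ := isCycleEnd_iff.2 ⟨Nat.succ_pos t, h⟩
      exact ⟨k, hk, Or.inr h⟩
    · refine ⟨k + 1, by omega, Or.inl ?_⟩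
      simp [cycleBegin, ← h]

lemma isBoundary_congr {t : ℕ} (h : ∀ s ∈ Finset.Icc 1 t, a s = a' s) :
    IsBoundary a t ↔ IsBoundary a' t := by
  induction t with
  | zero => simp [isBoundary_zero]
  | succ t ih =>
    rcases Nat.eq_zero_or_pos t with rfl | ht
    · simp [isBoundary_succ, isBoundary_zero]
    · rw [isBoundary_succ, isBoundary_succ,
        ih fun s hs => h s (Finset.Icc_subset_Icc_right t.le_succ hs),
        h (t + 1) (by simp), h t (Finset.mem_Icc.2 ⟨ht, t.le_succ⟩)]

lemma isCycleEndpoint_congr {t : ℕ} (ht : 1 ≤ t) (h : ∀ s ∈ Finset.Icc 1 t, a s = a' s) :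
    IsCycleEndpoint a t ↔ IsCycleEndpoint a' t := by
  obtain ⟨t, rfl⟩ := Nat.exists_eq_add_of_le' ht
  rw [isCycleEndpoint_succ_iff, isCycleEndpoint_succ_iff, isBoundary_congr h,
    isBoundary_congr fun s hs => h s (Finset.Icc_subset_Icc_right t.le_succ hs)]

/-! ### Cycle counts -/

lemma cycleCount_congr {t : ℕ} {i : Fin K} (h : ∀ s ∈ Finset.Icc 1 t, a s = a' s) :
    cycleCount a i t = cycleCount a' i t := by
  classical
  refine Finset.sum_congr rfl fun s hs => ?_
  obtain ⟨hs1, hst⟩ := Finset.mem_Icc.1 hs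
  rw [h s hs, isCycleEndpoint_congr hs1 fun r hr => h r (Finset.Icc_subset_Icc_right hst hr)]

@[simp] lemma cycleCount_zero {i : Fin K} : cycleCount a i 0 = 0 := by simp [cycleCount]

open Classical in
lemma cycleCount_succ (a : ℕ → Fin K) (i : Fin K) (t : ℕ) :
    cycleCount a i (t + 1) = cycleCount a i t +
      if a (t + 1) = i ∧ IsCycleEndpoint a (t + 1) then 1 else 0 := by
  rw [cycleCount, Finset.sum_Icc_succ_top (by omega), cycleCount]

lemma cycleCount_mono (i : Fin K) : Monotone (cycleCount a i) :=
  monotone_nat_of_le_succ fun t => by rw [cycleCount_succ]; omega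

lemma sum_cycleCount_le (t : ℕ) : ∑ i, cycleCount a i t ≤ t := by
  classical
  induction t with
  | zero => simp
  | succ t ih =>
    simp only [cycleCount_succ, Finset.sum_add_distrib]
    refine add_le_add ih ?_
    calc _ ≤ ∑ i, if a (t + 1) = i then 1 else 0 := by
          gcongr with i; split_ifs <;> simp_all
      _ = 1 := by simp

/-- Inside a cycle the first step has been counted for the current arm, and the last step brings a
different arm. Hence an arm is counted at most once per cycle. The increment over a cycle being at
most one, a batch cannot jump over its upper limit. -/
lemma cycleCount_le_of_batch {i : Fin K} {n U T : ℕ} (hn : IsBoundary a n)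
    (hU : cycleCount a i n < U)
    (hT : ∀ t, n < t → t < T → IsBoundary a t → cycleCount a i t ≠ U) {t : ℕ} (hnt : n ≤ t)
    (htT : t ≤ T) : cycleCount a i t ≤ U := by
  have key : ∀ t, n ≤ t → t ≤ T →
      ((IsBoundary a t → t < T → cycleCount a i t < U) ∧
      (¬ IsBoundary a t → a t ≠ i → cycleCount a i t < U) ∧ cycleCount a i t ≤ U) := by
    intro t hnt
    induction t, hnt using Nat.le_induction with
    | base => intro _; exact ⟨fun _ _ => hU, fun h => absurd hn h, hU.le⟩
    | succ t hnt ih =>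
      intro htT
      have ih := ih (by omega)
      have h1 := hT (t + 1) (by omega)
      have h2 := isBoundary_succ (a := a) (t := t)
      have h3 := isCycleEndpoint_succ_iff (a := a) (t := t)
      have h4 := cycleCount_succ a i t
      grind
  exact (key t hnt htT).2.2

end Paths

section Paths

variable {K : ℕ} {a a' : ℕ → Fin K} {α : ℝ}

/-- A cycle contains a step of an arm other than `l` that is counted, and at most one counted step
of the arm `l`. -/
lemma cycleCount_le_sum_erase {t : ℕ} (ht : IsBoundary a t) (l : Fin K) :
    cycleCount a l t ≤ ∑ i ∈ Finset.univ.erase l, cycleCount a i t := by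
  classical
  have hsum : ∀ t, ∑ i ∈ Finset.univ.erase l, cycleCount a i (t + 1) =
      ∑ i ∈ Finset.univ.erase l, cycleCount a i t +
        if a (t + 1) ≠ l ∧ IsCycleEndpoint a (t + 1) then 1 else 0 := by
    intro t
    simp only [cycleCount_succ, Finset.sum_add_distrib]
    congr 1
    by_cases h : a (t + 1) = l <;> by_cases h' : IsCycleEndpoint a (t + 1) <;>
      simp [h, h', eq_comm]
  have key : ∀ t, cycleCount a l t ≤ ∑ i ∈ Finset.univ.erase l, cycleCount a i t +
        (if ¬ IsBoundary a t ∧ a t = l then 1 else 0) ∧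
      (¬ IsBoundary a t → a t ≠ l →
        cycleCount a l t + 1 ≤ ∑ i ∈ Finset.univ.erase l, cycleCount a i t) := by
    intro t
    induction t with
    | zero => simp [isBoundary_zero]
    | succ t ih =>
      have h1 := hsum t
      have h2 := isBoundary_succ (a := a) (t := t)
      have h3 := isCycleEndpoint_succ_iff (a := a) (t := t)
      have h4 := cycleCount_succ a l t
      grind
  have := (key t).1
  simpa [ht] using this

open Classical in
/-- The steps at which a cycle that began with the arm `l` ends are at most as many as the
cycle beginnings with the arm `l`. -/
lemma card_switch_le_cycleCount (a : ℕ → Fin K) (l : Fin K) (t : ℕ) :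
    (∑ s ∈ Finset.Icc 1 t, if IsCycleEndpoint a s ∧ ¬ IsBoundary a (s - 1) ∧ a (s - 1) = l
      then 1 else 0) + (if ¬ IsBoundary a t ∧ a t = l then 1 else 0) ≤ cycleCount a l t := by
  induction t with
  | zero => simp [isBoundary_zero]
  | succ t ih =>
    rw [Finset.sum_Icc_succ_top (by omega)]
    have h2 := isBoundary_succ (a := a) (t := t)
    have h3 := isCycleEndpoint_succ_iff (a := a) (t := t)
    have h4 := cycleCount_succ a l t
    simp only [Nat.add_sub_cancel]
    grind

/-! ### Batches -/

lemma batchEnd_succ_eq_coe_iff {j n : ℕ} :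
    batchEnd α a (j + 1) = (n : ℕ∞) ↔
      (batchEnd α a j < n ∧ IsCycleEnd a n ∧
        ∃ i : Fin K, cycleCount a i n = upperLimit α a i (batchEnd α a j).toNat) ∧
      ∀ m < n, ¬ (batchEnd α a j < m ∧ IsCycleEnd a m ∧
        ∃ i : Fin K, cycleCount a i m = upperLimit α a i (batchEnd α a j).toNat) :=
  sInf_coe_eq_coe_iff (q := fun t n => batchEnd α a j < t ∧ IsCycleEnd a n ∧
        ∃ i : Fin K, cycleCount a i n = upperLimit α a i (batchEnd α a j).toNat)

lemma batchEnd_add_one_le (j : ℕ) : batchEnd α a j + 1 ≤ batchEnd α a (j + 1) :=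
  le_sInf fun _ ⟨_, _, h, _⟩ => Order.add_one_le_of_lt h

lemma batchEnd_mono : Monotone (batchEnd α a) :=
  monotone_nat_of_le_succ fun k => le_self_add.trans (batchEnd_add_one_le k)

lemma natCast_le_batchEnd (j : ℕ) : (j : ℕ∞) ≤ batchEnd α a j := by
  induction j with
  | zero => simp
  | succ k ih =>
    refine le_trans ?_ (batchEnd_add_one_le k)
    push_cast
    gcongr

lemma isBoundary_of_batchEnd_eq {j n : ℕ} (h : batchEnd α a j = n) : IsBoundary a n := by
  cases j with
  | zero =>
    have : n = 0 := by simpa [batchEnd, eq_comm] using h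
    exact this ▸ isBoundary_zero
  | succ j => exact (isCycleEnd_iff.1 (batchEnd_succ_eq_coe_iff.1 h).1.2.1).2

lemma cycleCount_lt_upperLimit (hα : 1 < α) (i : Fin K) (t : ℕ) :
    cycleCount a i t < upperLimit α a i t := by
  rcases Nat.eq_zero_or_pos (cycleCount a i t) with h | h
  · rw [h]; exact lt_max_of_lt_left one_pos
  · refine lt_max_of_lt_right (Nat.lt_ceil.2 ?_)
    have : (0 : ℝ) < cycleCount a i t := by exact_mod_cast h
    nlinarith

lemma upperLimit_le (hα : 1 < α) (i : Fin K) (t : ℕ) :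
    (upperLimit α a i t : ℝ) ≤ α * cycleCount a i t + 1 := by
  have h0 : 0 ≤ α * (cycleCount a i t : ℝ) := by positivity
  rw [upperLimit, Nat.cast_max, Nat.cast_one]
  exact max_le (by linarith) (Nat.ceil_lt_add_one h0).le

lemma batchEnd_lastBatch_le (α : ℝ) (a : ℕ → Fin K) (t : ℕ) :
    batchEnd α a (lastBatch α a t) ≤ ((t - 1 : ℕ) : ℕ∞) := by
  refine Nat.sSup_mem (s := {j : ℕ | batchEnd α a j ≤ ((t - 1 : ℕ) : ℕ∞)})
    ⟨0, by simp [batchEnd]⟩ ⟨t - 1, fun j hj => ?_⟩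
  exact_mod_cast (natCast_le_batchEnd (α := α) (a := a) j).trans hj

lemma lt_batchEnd_lastBatch_add_one (α : ℝ) (a : ℕ → Fin K) (t : ℕ) :
    ((t - 1 : ℕ) : ℕ∞) < batchEnd α a (lastBatch α a t + 1) := by
  by_contra h
  have := le_csSup (s := {j : ℕ | batchEnd α a j ≤ ((t - 1 : ℕ) : ℕ∞)})
    ⟨t - 1, fun j hj => by exact_mod_cast (natCast_le_batchEnd (α := α) (a := a) j).trans hj⟩
    (not_lt.1 h)
  exact absurd this (by simp [lastBatch])

lemma coe_lastBatchEnd (α : ℝ) (a : ℕ → Fin K) (t : ℕ) :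
    (lastBatchEnd α a t : ℕ∞) = batchEnd α a (lastBatch α a t) :=
  ENat.natCast_toNat (ne_top_of_le_ne_top (by simp) (batchEnd_lastBatch_le α a t))

lemma lastBatchEnd_le (α : ℝ) (a : ℕ → Fin K) (t : ℕ) : lastBatchEnd α a t ≤ t - 1 := by
  exact_mod_cast (coe_lastBatchEnd α a t).trans_le (batchEnd_lastBatch_le α a t)

lemma isBoundary_lastBatchEnd (α : ℝ) (a : ℕ → Fin K) (t : ℕ) :
    IsBoundary a (lastBatchEnd α a t) :=
  isBoundary_of_batchEnd_eq (coe_lastBatchEnd α a t).symm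

/-- Up to the end of a batch no cycle count exceeds the upper limit set at its start. -/
lemma cycleCount_le_upperLimit (hα : 1 < α) (i : Fin K) {t : ℕ} (ht : 1 ≤ t) :
    cycleCount a i t ≤ upperLimit α a i (lastBatchEnd α a t) := by
  have hle := lastBatchEnd_le α a t
  refine cycleCount_le_of_batch (isBoundary_lastBatchEnd α a t) (cycleCount_lt_upperLimit hα i _)
    (T := t) (fun s hs hst hb hs' => ?_) (by omega) le_rfl
  have hmem : batchEnd α a (lastBatch α a t + 1) ≤ s := by
    refine sInf_le ⟨s, rfl, ?_, isCycleEnd_iff.2 ⟨by omega, hb⟩, i, hs'⟩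
    rw [← coe_lastBatchEnd]
    exact_mod_cast hs
  have := (lt_batchEnd_lastBatch_add_one α a t).trans_le hmem
  have : t - 1 < s := by exact_mod_cast this
  omega

lemma cycleCount_le (hα : 1 < α) (i : Fin K) {t : ℕ} (ht : 1 ≤ t) :
    (cycleCount a i t : ℝ) ≤ α * cycleCount a i (lastBatchEnd α a t) + 1 :=
  (Nat.cast_le.2 (cycleCount_le_upperLimit hα i ht)).trans (upperLimit_le hα i _)

lemma batchIndex_le_lastBatch_add_one {t : ℕ} (ht : 1 ≤ t) :
    batchIndex α a t ≤ lastBatch α a t + 1 := by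
  refine Nat.sInf_le ⟨by omega, ?_⟩
  have := Order.add_one_le_of_lt (lt_batchEnd_lastBatch_add_one α a t)
  have h : ((t - 1 : ℕ) : ℕ∞) + 1 = t := by exact_mod_cast Nat.sub_add_cancel ht
  rwa [h] at this

lemma lastBatch_le (α : ℝ) (a : ℕ → Fin K) (t : ℕ) : lastBatch α a t ≤ t - 1 := by
  exact_mod_cast (natCast_le_batchEnd (α := α) (a := a) _).trans (batchEnd_lastBatch_le α a t)

lemma batchEnd_congr {n : ℕ} (h : ∀ s ∈ Finset.Icc 1 n, a s = a' s) (j : ℕ)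
    (hj : batchEnd α a j ≤ n) : batchEnd α a' j = batchEnd α a j := by
  induction j with
  | zero => rfl
  | succ j ih =>
    have hj' := ih ((batchEnd_mono (Nat.le_succ j)).trans hj)
    obtain ⟨m, hm, hmn⟩ : ∃ m : ℕ, batchEnd α a (j + 1) = m ∧ m ≤ n := by
      lift batchEnd α a (j + 1) to ℕ using ne_top_of_le_ne_top (by simp) hj with m hm
      exact ⟨m, rfl, by exact_mod_cast hj⟩
    have hsub : ∀ r ≤ m, ∀ s ∈ Finset.Icc 1 r, a s = a' s := fun r hr s hs =>
      h s (Finset.Icc_subset_Icc_right (hr.trans hmn) hs)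
    have hequiv : ∀ r ≤ m, (batchEnd α a j < r ∧ IsCycleEnd a r ∧
          ∃ i : Fin K, cycleCount a i r = upperLimit α a i (batchEnd α a j).toNat) →
        (batchEnd α a' j < r ∧ IsCycleEnd a' r ∧
          ∃ i : Fin K, cycleCount a' i r = upperLimit α a' i (batchEnd α a' j).toNat) := by
      rintro r hr ⟨h1, h2, i, h3⟩
      refine ⟨hj' ▸ h1, ?_, i, ?_⟩
      · rwa [isCycleEnd_iff, ← isBoundary_congr (hsub r hr), ← isCycleEnd_iff]
      · rw [← cycleCount_congr (hsub r hr), h3, hj', upperLimit, upperLimit, cycleCount_congr]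
        exact hsub _ ((ENat.toNat_le_of_le_natCast h1.le).trans hr)
    have hequiv' : ∀ r ≤ m, (batchEnd α a' j < r ∧ IsCycleEnd a' r ∧
          ∃ i : Fin K, cycleCount a' i r = upperLimit α a' i (batchEnd α a' j).toNat) →
        (batchEnd α a j < r ∧ IsCycleEnd a r ∧
          ∃ i : Fin K, cycleCount a i r = upperLimit α a i (batchEnd α a j).toNat) := by
      rintro r hr ⟨h1, h2, i, h3⟩
      refine ⟨hj' ▸ h1, ?_, i, ?_⟩
      · rwa [isCycleEnd_iff, isBoundary_congr (hsub r hr), ← isCycleEnd_iff]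
      · rw [cycleCount_congr (hsub r hr), h3, hj', upperLimit, upperLimit, ← cycleCount_congr]
        exact hsub _ ((ENat.toNat_le_of_le_natCast (hj' ▸ h1.le)).trans hr)
    have hd := batchEnd_succ_eq_coe_iff.1 hm
    rw [hm, batchEnd_succ_eq_coe_iff]
    exact ⟨hequiv m le_rfl hd.1, fun r hr hr' => hd.2 r hr (hequiv' r hr.le hr')⟩

lemma batchEnd_le_congr {n : ℕ} (h : ∀ s ∈ Finset.Icc 1 n, a s = a' s) (j : ℕ) :
    batchEnd α a j ≤ n ↔ batchEnd α a' j ≤ n :=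
  ⟨fun hj => (batchEnd_congr h j hj).trans_le hj,
    fun hj => (batchEnd_congr (fun s hs => (h s hs).symm) j hj).trans_le hj⟩

lemma lastBatchEnd_congr {t : ℕ} (h : ∀ s ∈ Finset.Icc 1 (t - 1), a s = a' s) :
    lastBatchEnd α a t = lastBatchEnd α a' t := by
  have : lastBatch α a t = lastBatch α a' t := by
    simp only [lastBatch, batchEnd_le_congr h]
  rw [lastBatchEnd, lastBatchEnd, ← this, batchEnd_congr h _ (batchEnd_lastBatch_le α a t)]

lemma batchIndex_congr {t : ℕ} (ht : 1 ≤ t) (h : ∀ s ∈ Finset.Icc 1 t, a s = a' s) :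
    batchIndex α a t = batchIndex α a' t := by
  have key : ∀ (b : ℕ → Fin K) j, (t : ℕ∞) ≤ batchEnd α b j ↔
      ¬ batchEnd α b j ≤ ((t - 1 : ℕ) : ℕ∞) := by
    intro b j
    have h1 : (t : ℕ∞) = ((t - 1 : ℕ) : ℕ∞) + 1 := by exact_mod_cast (Nat.sub_add_cancel ht).symm
    rw [h1, not_le, ENat.add_one_le_iff (by simp)]
  simp only [batchIndex, key]
  simp only [batchEnd_le_congr fun s hs => h s (Finset.Icc_subset_Icc_right (Nat.sub_le t 1) hs)]

/-- Each completed batch is charged to an arm whose cycle count reached its upper limit. If the arm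
`i` is charged `n i` times, its cycle count has grown by the factor `α` at every charge after the
first one, and by at least one at every charge. -/
lemma exists_charge (hα : 1 < α) (j : ℕ) {t : ℕ} (h : batchEnd α a j = t) :
    ∃ n : Fin K → ℕ, ∑ i, n i = j ∧
      ∀ i, n i ≤ cycleCount a i t ∧ (n i = 0 ∨ α ^ n i ≤ α * cycleCount a i t) := by
  induction j generalizing t with
  | zero => exact ⟨0, by simp, by simp⟩
  | succ j ih =>
    obtain ⟨⟨h1, -, l, hl⟩, -⟩ := batchEnd_succ_eq_coe_iff.1 h
    lift batchEnd α a j to ℕ using ne_top_of_lt h1 with m hm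
    obtain ⟨n, hsum, hn⟩ := ih rfl
    simp only [ENat.toNat_natCast] at hl
    have hmt : m ≤ t := by exact_mod_cast h1.le
    refine ⟨n + Pi.single l 1, by simp [Finset.sum_add_distrib, hsum], fun i => ?_⟩
    have hmono := cycleCount_mono (a := a) i hmt
    have hmono' : (cycleCount a i m : ℝ) ≤ cycleCount a i t := by exact_mod_cast hmono
    obtain ⟨hn1, hn2⟩ := hn i
    by_cases hi : i = l
    · subst hi
      have hlt := cycleCount_lt_upperLimit (a := a) hα i m
      simp only [Pi.add_apply, Pi.single_eq_same]
      refine ⟨by omega, Or.inr ?_⟩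
      rcases hn2 with h0 | hn2
      · have : (1 : ℝ) ≤ cycleCount a i t := by
          rw [hl]; exact_mod_cast (Nat.succ_le_of_lt (Nat.zero_le _ |>.trans_lt hlt))
        rw [h0, zero_add, pow_one]
        nlinarith
      · have : α * cycleCount a i m ≤ cycleCount a i t := by
          rw [hl]
          exact (Nat.le_ceil _).trans (Nat.cast_le.2 (le_max_right _ _))
        rw [pow_succ']
        exact mul_le_mul_of_nonneg_left (hn2.trans this) (by linarith)
    · simp only [Pi.add_apply, Pi.single_eq_of_ne hi, add_zero]
      exact ⟨hn1.trans hmono, hn2.imp_right fun h =>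
        h.trans (mul_le_mul_of_nonneg_left hmono' (by linarith))⟩

end Paths

section Paths

variable {K : ℕ} {a : ℕ → Fin K} {α : ℝ}

/-! ### Bounds on the batch complexity along a path -/

/-- The batches that precede the one containing `T` are distributed over the arms; the arm `i`
receives at most `M_i` of them, and at most `1 + log_α M_i`. -/
lemma exists_batchIndex_le (hα : 1 < α) {T : ℕ} (hT : 1 ≤ T) :
    ∃ n : Fin K → ℕ, batchIndex α a T ≤ 1 + ∑ i, n i ∧
      ∀ i, n i ≤ cycleCount a i (lastBatchEnd α a T) ∧
        (n i = 0 ∨ (n i : ℝ) ≤ 1 + Real.logb α (cycleCount a i (lastBatchEnd α a T))) := by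
  obtain ⟨n, hsum, hn⟩ := exists_charge hα _ (coe_lastBatchEnd α a T).symm
  refine ⟨n, ?_, fun i => ⟨(hn i).1, ?_⟩⟩
  · rw [hsum, add_comm]
    exact batchIndex_le_lastBatch_add_one hT
  · rcases Nat.eq_zero_or_pos (n i) with h0 | hpos
    · exact Or.inl h0
    · refine Or.inr ?_
      have hα0 : 0 < α := by linarith
      have hM : (0 : ℝ) < cycleCount a i (lastBatchEnd α a T) := by
        exact_mod_cast hpos.trans_le (hn i).1
      have h := (hn i).2.resolve_left hpos.ne'
      have h' := Real.logb_le_logb_of_le hα (by positivity) h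
      rwa [Real.logb_mul hα0.ne' hM.ne', Real.logb_self_eq_one hα, Real.logb_pow,
        Real.logb_self_eq_one hα, mul_one] at h'

/-- The function `x ↦ min x (1 + log_α x)`, extended by `0` to `x = 0`, lies below a line of
nonnegative slope that passes through the point `(y, 1 + log_α y)`. -/
lemma exists_slope (hα : 1 < α) {y : ℝ} (hy : 1 ≤ y) :
    ∃ s : ℝ, 0 ≤ s ∧ ∀ n x : ℕ, n ≤ x → (n = 0 ∨ (n : ℝ) ≤ 1 + Real.logb α x) →
      (n : ℝ) ≤ 1 + Real.logb α y + s * (x - y) := by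
  have hlα : 0 < Real.log α := Real.log_pos hα
  have hy0 : 0 < y := by linarith
  have hly : 0 ≤ Real.log y := Real.log_nonneg hy
  by_cases hcase : 1 ≤ Real.log α + Real.log y
  · -- the tangent at `y`, which is nonnegative at `0`
    refine ⟨1 / (y * Real.log α), by positivity, fun n x hnx hn => ?_⟩
    have hx : (0 : ℝ) ≤ x := by positivity
    have e : 1 + Real.logb α y + 1 / (y * Real.log α) * (x - y) =
        (Real.log α + Real.log y - 1 + x / y) / Real.log α := by
      rw [Real.logb]; field_simp; ring
    rw [e]
    rcases Nat.eq_zero_or_pos n with h0 | hpos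
    · rw [h0, Nat.cast_zero]
      have : 0 ≤ (x : ℝ) / y := by positivity
      exact div_nonneg (by linarith) hlα.le
    · have hxpos : (0 : ℝ) < x := by exact_mod_cast hpos.trans_le hnx
      refine (hn.resolve_left hpos.ne').trans ?_
      rw [le_div_iff₀ hlα, Real.logb, add_mul, div_mul_cancel₀ _ hlα.ne']
      have := Real.log_le_sub_one_of_pos (div_pos hxpos hy0)
      rw [Real.log_div hxpos.ne' hy0.ne'] at this
      linarith
  · -- here `1 + log_α y ≥ y`, and the bound `n ≤ x` suffices
    refine ⟨1, zero_le_one, fun n x hnx _ => ?_⟩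
    have hnx' : (n : ℝ) ≤ x := by exact_mod_cast hnx
    have hkey : y - 1 ≤ Real.logb α y := by
      rw [Real.logb, le_div_iff₀ hlα]
      have h1 := Real.one_sub_inv_le_log_of_pos hy0
      have h2 : (y - 1) ≤ y * Real.log y := by
        have := mul_le_mul_of_nonneg_left h1 hy0.le
        rwa [mul_sub, mul_one, mul_inv_cancel₀ hy0.ne'] at this
      push Not at hcase
      nlinarith
    linarith

lemma batchIndex_le_of_le (hα : 1 < α) {T : ℕ} (hK : 1 ≤ K) (hKT : K ≤ T) :
    (batchIndex α a T : ℝ) ≤ 1 + K + K * Real.logb α (T / K) := by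
  obtain ⟨n, hB, hn⟩ := exists_batchIndex_le (a := a) hα (hK.trans hKT)
  have hK0 : (0 : ℝ) < K := by exact_mod_cast hK
  have hy : (1 : ℝ) ≤ T / K := by rw [le_div_iff₀ hK0, one_mul]; exact_mod_cast hKT
  obtain ⟨s, hs, hslope⟩ := exists_slope hα hy
  have hB' : (batchIndex α a T : ℝ) ≤ 1 + ∑ i, (n i : ℝ) := by exact_mod_cast hB
  have hM : (∑ i, (cycleCount a i (lastBatchEnd α a T) : ℝ)) ≤ T := by
    have := (sum_cycleCount_le (a := a) _).trans
      ((lastBatchEnd_le α a T).trans (Nat.sub_le T 1))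
    exact_mod_cast this
  have hsum : ∑ i, (n i : ℝ) ≤ ∑ i : Fin K, (1 + Real.logb α (T / K) +
      s * (cycleCount a i (lastBatchEnd α a T) - T / K)) :=
    Finset.sum_le_sum fun i _ => hslope _ _ (hn i).1 (hn i).2
  rw [Finset.sum_add_distrib, ← Finset.mul_sum, Finset.sum_sub_distrib] at hsum
  simp only [Finset.sum_const, Finset.card_univ, Fintype.card_fin, nsmul_eq_mul] at hsum
  rw [mul_div_cancel₀ _ hK0.ne'] at hsum
  nlinarith [mul_le_mul_of_nonneg_left (sub_nonpos.2 hM) hs]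

lemma cycleCount_lastBatchEnd_le (i : Fin K) (T : ℕ) :
    cycleCount a i (lastBatchEnd α a T) ≤ cycleCount a i T :=
  cycleCount_mono i ((lastBatchEnd_le α a T).trans (Nat.sub_le T 1))

variable [NeZero K]

lemma cycleCount_zero_lastBatchEnd_le (T : ℕ) :
    cycleCount a 0 (lastBatchEnd α a T) ≤ ∑ i ∈ Finset.univ.erase 0, cycleCount a i T :=
  (cycleCount_le_sum_erase (isBoundary_lastBatchEnd α a T) 0).trans
    (Finset.sum_le_sum fun i _ => cycleCount_lastBatchEnd_le i T)

lemma batchIndex_le_sum (hα : 1 < α) {T : ℕ} (hT : 1 ≤ T) :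
    batchIndex α a T ≤ 1 + 2 * ∑ i ∈ Finset.univ.erase (0 : Fin K), cycleCount a i T := by
  obtain ⟨n, hB, hn⟩ := exists_batchIndex_le (a := a) hα hT
  refine hB.trans ?_
  rw [← Finset.add_sum_erase _ _ (Finset.mem_univ (0 : Fin K)), two_mul]
  gcongr with i
  · exact (hn 0).1.trans (cycleCount_zero_lastBatchEnd_le T)
  · exact (hn i).1.trans (cycleCount_lastBatchEnd_le i T)

lemma batchIndex_le_sum_logb (hα : 1 < α) {T : ℕ} (hT : 1 ≤ T) :
    (batchIndex α a T : ℝ) ≤ 1 + K +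
      Real.logb α (1 + ∑ i ∈ Finset.univ.erase (0 : Fin K), (cycleCount a i T : ℝ)) +
      ∑ i ∈ Finset.univ.erase (0 : Fin K), Real.logb α (1 + cycleCount a i T) := by
  obtain ⟨n, hB, hn⟩ := exists_batchIndex_le (a := a) hα hT
  have hB' : (batchIndex α a T : ℝ) ≤ 1 + ∑ i, (n i : ℝ) := by exact_mod_cast hB
  have key : ∀ i (x : ℝ), cycleCount a i (lastBatchEnd α a T) ≤ x →
      (n i : ℝ) ≤ 1 + Real.logb α (1 + x) := by
    intro i x hx
    have hx0 : 0 ≤ x := le_trans (by positivity) hx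
    rcases Nat.eq_zero_or_pos (n i) with h0 | hpos
    · have := Real.logb_nonneg hα (x := 1 + x) (by linarith)
      rw [h0, Nat.cast_zero]; linarith
    · have hM : (0 : ℝ) < cycleCount a i (lastBatchEnd α a T) := by
        exact_mod_cast hpos.trans_le (hn i).1
      have := Real.logb_le_logb_of_le hα hM (hx.trans (by linarith : x ≤ 1 + x))
      exact ((hn i).2.resolve_left hpos.ne').trans (by linarith)
  have h0 := key 0 (∑ i ∈ Finset.univ.erase (0 : Fin K), (cycleCount a i T : ℝ))
    (by exact_mod_cast cycleCount_zero_lastBatchEnd_le T)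
  have hi : ∑ i ∈ Finset.univ.erase (0 : Fin K), (n i : ℝ) ≤
      ∑ i ∈ Finset.univ.erase (0 : Fin K), (1 + Real.logb α (1 + cycleCount a i T)) :=
    Finset.sum_le_sum fun i _ => key i _ (by exact_mod_cast cycleCount_lastBatchEnd_le i T)
  have hcard : (∑ _i ∈ Finset.univ.erase (0 : Fin K), (1 : ℝ)) = K - 1 := by
    rw [Finset.sum_const, Finset.card_erase_of_mem (Finset.mem_univ _), Finset.card_univ,
      Fintype.card_fin, nsmul_one, Nat.cast_sub (Nat.one_le_iff_ne_zero.2 (NeZero.ne K)),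
      Nat.cast_one]
  rw [← Finset.add_sum_erase _ _ (Finset.mem_univ (0 : Fin K))] at hB'
  rw [Finset.sum_add_distrib, hcard] at hi
  linarith

end Paths

/-! ### Independence of sub-σ-algebras up to null sets -/

section Independence

variable {Ω : Type*} {m m₁ m₂ m₃ mΩ : MeasurableSpace Ω} {P : Measure Ω}

lemma indep_sup_right [IsZeroOrProbabilityMeasure P] (h1 : m₁ ≤ mΩ) (h2 : m₂ ≤ mΩ) (h3 : m₃ ≤ mΩ)
    (h : Indep m₁ m₂ P) (h' : Indep (m₁ ⊔ m₂) m₃ P) : Indep m₁ (m₂ ⊔ m₃) P := by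
  refine IndepSets.indep (p1 := {s | MeasurableSet[m₁] s})
    (p2 := Set.image2 (· ∩ ·) {s | MeasurableSet[m₂] s} {s | MeasurableSet[m₃] s}) h1
    (sup_le h2 h3) (@MeasurableSpace.isPiSystem_measurableSet _ m₁) ?_
    (@MeasurableSpace.generateFrom_measurableSet _ m₁).symm ?_ ?_
  · rintro _ ⟨s, hs, t, ht, rfl⟩ _ ⟨s', hs', t', ht', rfl⟩ -
    exact ⟨s ∩ s', @MeasurableSet.inter _ m₂ _ _ hs hs', t ∩ t',
      @MeasurableSet.inter _ m₃ _ _ ht ht', Set.inter_inter_inter_comm _ _ _ _⟩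
  · refine le_antisymm (sup_le (fun s hs => ?_) fun s hs => ?_)
      (MeasurableSpace.generateFrom_le ?_)
    · exact MeasurableSpace.measurableSet_generateFrom
        ⟨s, hs, Set.univ, @MeasurableSet.univ _ m₃, Set.inter_univ s⟩
    · exact MeasurableSpace.measurableSet_generateFrom
        ⟨Set.univ, @MeasurableSet.univ _ m₂, s, hs, Set.univ_inter s⟩
    · rintro _ ⟨s, hs, t, ht, rfl⟩
      exact @MeasurableSet.inter _ (m₂ ⊔ m₃) _ _ (le_sup_left (a := m₂) s hs)
        (le_sup_right (a := m₂) t ht)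
  · rw [IndepSets_iff]
    rintro s _ hs ⟨t, ht, u, hu, rfl⟩
    rw [Indep_iff] at h h'
    have e1 := h' (s ∩ t) u (@MeasurableSet.inter _ (m₁ ⊔ m₂) _ _ (le_sup_left (a := m₁) s hs)
      (le_sup_right (a := m₁) t ht)) hu
    have e2 := h' t u (le_sup_right (a := m₁) t ht) hu
    simp only [← Set.inter_assoc]
    rw [e1, h s t hs ht, e2, mul_assoc]

/-- The measurable sets that agree with a set of `m` up to a null set. -/
@[reducible] def nullExtension (P : Measure Ω) (m : MeasurableSpace Ω) : MeasurableSpace Ω :=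
  eventuallyMeasurableSpace m (ae P) ⊓ mΩ

lemma nullExtension_le : nullExtension P m ≤ mΩ := inf_le_right

lemma le_nullExtension (h : m ≤ mΩ) : m ≤ nullExtension P m :=
  le_inf le_eventuallyMeasurableSpace h

lemma measurableSet_nullExtension {s t : Set Ω} (hs : MeasurableSet s)
    (ht : MeasurableSet[nullExtension P m] t) (h : s =ᵐ[P] t) :
    MeasurableSet[nullExtension P m] s :=
  MeasurableSpace.measurableSet_inf.2
    ⟨EventuallyMeasurableSet.congr (MeasurableSpace.measurableSet_inf.1 ht).1 h, hs⟩

lemma indep_nullExtension (h : Indep m₁ m P) : Indep m₁ (nullExtension P m) P := by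
  rw [Indep_iff] at h ⊢
  intro s t hs ht
  obtain ⟨t', ht', htt'⟩ := (MeasurableSpace.measurableSet_inf.1 ht).1
  rw [measure_congr htt', measure_congr ((ae_eq_refl s).inter htt'), h s t' hs ht']

lemma indepFun_of_indep {β γ : Type*} [MeasurableSpace β] [MeasurableSpace γ] {X : Ω → β}
    {V : Ω → γ} (h : Indep (MeasurableSpace.comap X inferInstance) m P) (hV : Measurable[m] V) :
    IndepFun V X P :=
  (indep_of_indep_of_le_right h hV.comap_le).symm

/-- Integrating out a variable that is independent of the rest of the integrand. -/
lemma lintegral_indepFun {β γ : Type*} [MeasurableSpace β] [MeasurableSpace γ]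
    [IsFiniteMeasure P] {X : Ω → β} {V : Ω → γ} (hX : Measurable X) (hV : Measurable V)
    (h : IndepFun V X P) {f : γ × β → ENNReal} (hf : Measurable f) :
    ∫⁻ ω, f (V ω, X ω) ∂P = ∫⁻ ω, ∫⁻ x, f (V ω, x) ∂(P.map X) ∂P := by
  rw [← lintegral_map hf (hV.prodMk hX), (indepFun_iff_map_prod_eq_prod_map_map hV.aemeasurable
    hX.aemeasurable).1 h, lintegral_prod _ hf.aemeasurable,
    lintegral_map hf.lintegral_prod_right' hV]

lemma measure_eq_zero_of_indepFun [IsFiniteMeasure P] {X V : Ω → ℝ} (hX : Measurable X)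
    (hV : Measurable V) (h : IndepFun V X P) (hna : NullSingletonClass (P.map X)) :
    P {ω | X ω = V ω} = 0 := by
  have hD : MeasurableSet {p : ℝ × ℝ | p.2 = p.1} :=
    measurableSet_eq_fun measurable_snd measurable_fst
  have := lintegral_indepFun hX hV h (f := {p : ℝ × ℝ | p.2 = p.1}.indicator 1)
    (measurable_one.indicator hD)
  rw [show (fun ω => {p : ℝ × ℝ | p.2 = p.1}.indicator (1 : ℝ × ℝ → ENNReal) (V ω, X ω)) =
    {ω | X ω = V ω}.indicator 1 from rfl,
    lintegral_indicator_one (measurableSet_eq_fun hX hV)] at this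
  rw [this]
  refine (lintegral_congr fun ω => ?_).trans lintegral_zero
  rw [show (fun x => {p : ℝ × ℝ | p.2 = p.1}.indicator (1 : ℝ × ℝ → ENNReal) (V ω, x)) =
    ({V ω} : Set ℝ).indicator 1 from rfl, lintegral_indicator_one (measurableSet_singleton _),
    measure_singleton]

end Independence

/-! ### Quantities determined by the arms played so far -/

section Local

variable {Ω : Type*} {m : MeasurableSpace Ω} {K : ℕ} [NeZero K] {A : ℕ → Ω → Fin K} {t : ℕ}

/-- Functions of the played arms that depend on the first `t` arms only are measurable. -/
lemma measurable_of_local {β : Type*} [MeasurableSpace β]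
    (hA : ∀ s ∈ Finset.Icc 1 t, Measurable (A s)) {f : (ℕ → Fin K) → β}
    (hf : ∀ a a' : ℕ → Fin K, (∀ s ∈ Finset.Icc 1 t, a s = a' s) → f a = f a') :
    Measurable fun ω => f fun s => A s ω := by
  let e : (Finset.Icc 1 t → Fin K) → ℕ → Fin K := fun x s => if h : s ∈ Finset.Icc 1 t then x ⟨s, h⟩
    else 0
  have he : (fun ω => f fun s => A s ω) = (fun x => f (e x)) ∘ fun ω (s : Finset.Icc 1 t) =>
      A s ω := by
    ext ω
    exact hf _ _ fun s hs => by simp only [e, dif_pos hs]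
  rw [he]
  exact Measurable.of_discrete.comp (measurable_pi_lambda _ fun s => hA s s.2)

lemma measurableSet_of_local (hA : ∀ s ∈ Finset.Icc 1 t, Measurable (A s))
    {p : (ℕ → Fin K) → Prop}
    (hp : ∀ a a' : ℕ → Fin K, (∀ s ∈ Finset.Icc 1 t, a s = a' s) → (p a ↔ p a')) :
    MeasurableSet {ω | p fun s => A s ω} :=
  measurableSet_setOfPred.2 (measurable_of_local hA fun a a' h => propext (hp a a' h))

lemma measurable_rewardSum_comp {Y : Fin K → ℕ → Ω → ℝ} {i : Fin K}
    (hA : ∀ s ∈ Finset.Icc 1 t, Measurable (A s)) (hY : ∀ s ∈ Finset.Icc 1 t, Measurable (Y i s))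
    {τ : (ℕ → Fin K) → ℕ} (hτt : ∀ a, τ a ≤ t)
    (hτ : ∀ a a' : ℕ → Fin K, (∀ s ∈ Finset.Icc 1 t, a s = a' s) → τ a = τ a') :
    Measurable fun ω => rewardSum (fun s => A s ω) (fun l s => Y l s ω) i (τ fun s => A s ω) := by
  classical
  have e : ∀ ω, rewardSum (fun s => A s ω) (fun l s => Y l s ω) i (τ fun s => A s ω) =
      ∑ s ∈ Finset.Icc 1 t, if s ≤ τ (fun s => A s ω) ∧ A s ω = i ∧
        IsCycleEndpoint (fun s => A s ω) s then Y i s ω else 0 := by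
    intro ω
    rw [rewardSum, ← Finset.sum_subset (Finset.Icc_subset_Icc_right (hτt fun s => A s ω))]
    · refine Finset.sum_congr rfl fun s hs => ?_
      simp [(Finset.mem_Icc.1 hs).2]
    · intro s hs hs'
      refine if_neg fun h => hs' (Finset.mem_Icc.2 ⟨(Finset.mem_Icc.1 hs).1, h.1⟩)
  simp_rw [e]
  refine Finset.measurable_sum _ fun s hs => Measurable.ite ?_ (hY s hs) measurable_const
  refine measurableSet_of_local hA (p := fun a => s ≤ τ a ∧ a s = i ∧ IsCycleEndpoint a s)
    fun a a' h => ?_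
  obtain ⟨hs1, hst⟩ := Finset.mem_Icc.1 hs
  rw [hτ a a' h, h s hs,
    isCycleEndpoint_congr hs1 fun r hr => h r (Finset.Icc_subset_Icc_right hst hr)]

lemma measurable_sample {Y Z : Fin K → ℕ → Ω → ℝ} {α σ : ℝ} {i : Fin K}
    (hA : ∀ s ∈ Finset.Icc 1 (t - 1), Measurable (A s))
    (hY : ∀ s ∈ Finset.Icc 1 (t - 1), Measurable (Y i s)) (hZ : Measurable (Z i t)) :
    Measurable fun ω => sample α σ (fun s => A s ω) (fun l s => Y l s ω) i t (Z i t ω) := by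
  have h1 := measurable_rewardSum_comp hA hY (τ := fun a => lastBatchEnd α a t)
    (fun a => lastBatchEnd_le α a t) fun a a' h => lastBatchEnd_congr h
  have h2 : Measurable fun ω => (cycleCount (fun s => A s ω) i
      (lastBatchEnd α (fun s => A s ω) t) : ℝ) :=
    measurable_of_local hA (f := fun a => (cycleCount a i (lastBatchEnd α a t) : ℝ)) fun a a' h => by
      rw [lastBatchEnd_congr h, cycleCount_congr fun s hs => h s
        (Finset.Icc_subset_Icc_right (lastBatchEnd_le α a' t) hs)]
  unfold sample
  exact (h1.div (h2.const_add 1)).add (((measurable_const.div (h2.const_add 1)).sqrt).mul hZ)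

end Local

/-! ### Adaptedness of the played arms -/

section Adapted

variable {Ω : Type u} {K : ℕ}

/-- The information of all noise variables and of all rewards except those at time `s + 1`. -/
@[reducible] def complReward (Y Z : Fin K → ℕ → Ω → ℝ) (s : ℕ) : MeasurableSpace Ω :=
  (⨆ r ∈ ({s}ᶜ : Set ℕ), MeasurableSpace.comap (fun (ω : Ω) (i : Fin K) => Y i (r + 1) ω)
    inferInstance) ⊔
  MeasurableSpace.comap (fun (ω : Ω) (p : Fin K × ℕ) => Z p.1 (p.2 + 1) ω) inferInstance

/-- The information of all rewards and of all noise variables except that of the arm `p.1` at time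
`p.2 + 1`. -/
@[reducible] def complNoise (Y Z : Fin K → ℕ → Ω → ℝ) (p : Fin K × ℕ) : MeasurableSpace Ω :=
  (⨆ q ∈ ({p}ᶜ : Set (Fin K × ℕ)), MeasurableSpace.comap (fun ω : Ω => Z q.1 (q.2 + 1) ω)
    inferInstance) ⊔
  MeasurableSpace.comap (fun (ω : Ω) (p : Fin K × ℕ) => Y p.1 (p.2 + 1) ω) inferInstance

lemma measurable_comap_apply {ι : Type*} (f : Ω → ι → ℝ) (i : ι) :
    Measurable[MeasurableSpace.comap f inferInstance] fun ω => f ω i :=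
  (measurable_pi_apply i).comp (comap_measurable f)

variable {Y Z : Fin K → ℕ → Ω → ℝ}

lemma measurable_complReward_noise {s t : ℕ} (ht : 1 ≤ t) (i : Fin K) :
    Measurable[complReward Y Z s] (Z i t) := by
  obtain ⟨t, rfl⟩ := Nat.exists_eq_add_of_le' ht
  exact (measurable_comap_apply (fun (ω : Ω) (p : Fin K × ℕ) => Z p.1 (p.2 + 1) ω) (i, t)).mono
    le_sup_right le_rfl

lemma measurable_complReward_reward {s t : ℕ} (ht : 1 ≤ t) (hts : t ≠ s + 1) (i : Fin K) :
    Measurable[complReward Y Z s] (Y i t) := by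
  obtain ⟨t, rfl⟩ := Nat.exists_eq_add_of_le' ht
  refine (measurable_comap_apply (fun (ω : Ω) (i : Fin K) => Y i (t + 1) ω) i).mono
    (le_sup_of_le_left ?_) le_rfl
  exact le_iSup₂_of_le (f := fun r (_ : r ∈ ({s}ᶜ : Set ℕ)) => MeasurableSpace.comap
    (fun (ω : Ω) (i : Fin K) => Y i (r + 1) ω) inferInstance) t (by simpa using hts) le_rfl

lemma measurable_complNoise_reward {p : Fin K × ℕ} {t : ℕ} (ht : 1 ≤ t) (i : Fin K) :
    Measurable[complNoise Y Z p] (Y i t) := by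
  obtain ⟨t, rfl⟩ := Nat.exists_eq_add_of_le' ht
  exact (measurable_comap_apply (fun (ω : Ω) (p : Fin K × ℕ) => Y p.1 (p.2 + 1) ω) (i, t)).mono
    le_sup_right le_rfl

lemma measurable_complNoise_noise {p : Fin K × ℕ} {t : ℕ} (ht : 1 ≤ t) {i : Fin K}
    (h : i ≠ p.1 ∨ t ≠ p.2 + 1) : Measurable[complNoise Y Z p] (Z i t) := by
  obtain ⟨t, rfl⟩ := Nat.exists_eq_add_of_le' ht
  refine (comap_measurable (Z i (t + 1))).mono (le_sup_of_le_left ?_) le_rfl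
  refine le_iSup₂_of_le (f := fun q (_ : q ∈ ({p}ᶜ : Set (Fin K × ℕ))) => MeasurableSpace.comap
    (fun ω : Ω => Z q.1 (q.2 + 1) ω) inferInstance) (i, t) ?_ le_rfl
  rintro rfl
  simp at h

variable {m : MeasurableSpace Ω} [mΩ : MeasurableSpace Ω] {P : Measure Ω} {A : ℕ → Ω → Fin K}
  {α σ : ℝ}

lemma IsBatchedThompsonSampling.measurable_all (hA : IsBatchedThompsonSampling P α σ Y Z A) :
    Measurable fun (ω : Ω) (p : Fin K × ℕ) => Z p.1 (p.2 + 1) ω :=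
  measurable_pi_lambda _ fun p => hA.measurable_noise p.1 _ (by omega)

variable [NeZero K]

lemma IsBandit.measurable_all (hB : IsBandit P Y) :
    Measurable fun (ω : Ω) (p : Fin K × ℕ) => Y p.1 (p.2 + 1) ω :=
  measurable_pi_lambda _ fun p => hB.measurable p.1 _ (by omega)

lemma complReward_le (hB : IsBandit P Y) (hA : IsBatchedThompsonSampling P α σ Y Z A) (s : ℕ) :
    complReward Y Z s ≤ mΩ :=
  sup_le (iSup₂_le fun r _ => (measurable_pi_lambda _ fun i =>
    hB.measurable i (r + 1) (by omega)).comap_le) hA.measurable_all.comap_le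

lemma complNoise_le (hB : IsBandit P Y) (hA : IsBatchedThompsonSampling P α σ Y Z A)
    (p : Fin K × ℕ) : complNoise Y Z p ≤ mΩ :=
  sup_le (iSup₂_le fun q _ => (hA.measurable_noise q.1 (q.2 + 1) (by omega)).comap_le)
    hB.measurable_all.comap_le

variable [IsProbabilityMeasure P]

lemma indep_complReward (hB : IsBandit P Y) (hA : IsBatchedThompsonSampling P α σ Y Z A) (s : ℕ) :
    Indep (MeasurableSpace.comap (fun (ω : Ω) (i : Fin K) => Y i (s + 1) ω) inferInstance)
      (nullExtension P (complReward Y Z s)) P := by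
  have hYm : ∀ r, Measurable fun (ω : Ω) (i : Fin K) => Y i (r + 1) ω := fun r =>
    measurable_pi_lambda _ fun i => hB.measurable i (r + 1) (by omega)
  have h1 := indep_iSup_of_disjoint (fun r => (hYm r).comap_le) hB.indep
    (S := {s}) (T := {s}ᶜ) disjoint_compl_right
  simp only [Set.mem_singleton_iff, iSup_iSup_eq_left] at h1
  refine indep_nullExtension (indep_sup_right (hYm s).comap_le
    (iSup₂_le fun r _ => (hYm r).comap_le) hA.measurable_all.comap_le h1 ?_)
  have hle : ∀ r, MeasurableSpace.comap (fun (ω : Ω) (i : Fin K) => Y i (r + 1) ω) inferInstance ≤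
      MeasurableSpace.comap (fun (ω : Ω) (p : Fin K × ℕ) => Y p.1 (p.2 + 1) ω) inferInstance :=
    fun r => Measurable.comap_le (@measurable_pi_lambda _ _ _ (_) _ _ fun i =>
      measurable_comap_apply (fun (ω : Ω) (p : Fin K × ℕ) => Y p.1 (p.2 + 1) ω) (i, r))
  exact indep_of_indep_of_le_left hA.indep_rewards (sup_le (hle s) (iSup₂_le fun r _ => hle r))

lemma indep_complNoise (hB : IsBandit P Y) (hA : IsBatchedThompsonSampling P α σ Y Z A)
    (p : Fin K × ℕ) :
    Indep (MeasurableSpace.comap (fun ω : Ω => Z p.1 (p.2 + 1) ω) inferInstance)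
      (nullExtension P (complNoise Y Z p)) P := by
  have hZm : ∀ q : Fin K × ℕ, Measurable fun ω : Ω => Z q.1 (q.2 + 1) ω := fun q =>
    hA.measurable_noise q.1 (q.2 + 1) (by omega)
  have h1 := indep_iSup_of_disjoint (fun q => (hZm q).comap_le) hA.indep_noise
    (S := {p}) (T := {p}ᶜ) disjoint_compl_right
  simp only [Set.mem_singleton_iff, iSup_iSup_eq_left] at h1
  refine indep_nullExtension (indep_sup_right (hZm p).comap_le
    (iSup₂_le fun r _ => (hZm r).comap_le) hB.measurable_all.comap_le h1 ?_)
  have hle : ∀ q : Fin K × ℕ, MeasurableSpace.comap (fun ω : Ω => Z q.1 (q.2 + 1) ω) inferInstance ≤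
      MeasurableSpace.comap (fun (ω : Ω) (p : Fin K × ℕ) => Z p.1 (p.2 + 1) ω) inferInstance :=
    fun q => Measurable.comap_le
      (measurable_comap_apply (fun (ω : Ω) (p : Fin K × ℕ) => Z p.1 (p.2 + 1) ω) q)
  exact indep_of_indep_of_le_left hA.indep_rewards.symm
    (sup_le (hle p) (iSup₂_le fun q _ => hle q))

/-- The sample `θ_i(t)` as a random variable. -/
def theta (α σ : ℝ) (Y Z : Fin K → ℕ → Ω → ℝ) (A : ℕ → Ω → Fin K) (i : Fin K) (t : ℕ) (ω : Ω) : ℝ :=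
  sample α σ (fun s => A s ω) (fun l s => Y l s ω) i t (Z i t ω)

omit [IsProbabilityMeasure P] in
/-- Without ties the arm played at time `t` is determined by the rewards before `t` and the noise up
to `t`. -/
lemma measurable_arm_of_no_tie (hA : IsBatchedThompsonSampling P α σ Y Z A) (t : ℕ)
    (htie : ∀ s ∈ Finset.Icc 1 t, ∀ i l, i ≠ l →
      P {ω | theta α σ Y Z A i s ω = theta α σ Y Z A l s ω} = 0)
    (hm : m ≤ mΩ) (hY : ∀ i s, 1 ≤ s → s < t → Measurable[m] (Y i s))
    (hZ : ∀ i s, 1 ≤ s → s ≤ t → Measurable[m] (Z i s)) :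
    ∀ s ∈ Finset.Icc 1 t, Measurable[nullExtension P m] (A s) := by
  induction t with
  | zero => simp
  | succ t ih =>
    intro s hs
    have hIH := ih (fun s hs => htie s (Finset.Icc_subset_Icc_right t.le_succ hs))
      (fun i s h1 h2 => hY i s h1 (by omega)) fun i s h1 h2 => hZ i s h1 (by omega)
    obtain ⟨hs1, hst⟩ := Finset.mem_Icc.1 hs
    rcases Nat.lt_or_ge s (t + 1) with hlt | hge
    · exact hIH s (Finset.mem_Icc.2 ⟨hs1, by omega⟩)
    obtain rfl : s = t + 1 := by omega
    have hθm : ∀ i, Measurable[nullExtension P m] (theta α σ Y Z A i (t + 1)) := fun i =>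
      measurable_sample (t := t + 1) hIH (fun s hs => (hY i s (Finset.mem_Icc.1 hs).1
        (Nat.lt_succ_of_le (Finset.mem_Icc.1 hs).2)).mono (le_nullExtension hm) le_rfl)
        ((hZ i (t + 1) (by omega) le_rfl).mono (le_nullExtension hm) le_rfl)
    refine @measurable_to_countable' _ _ (_) _ (nullExtension P m) _ fun i => ?_
    refine measurableSet_nullExtension
      (t := {ω | ∀ l, theta α σ Y Z A l (t + 1) ω ≤ theta α σ Y Z A i (t + 1) ω})
      (hA.measurable_arm (t + 1) (by omega) (measurableSet_singleton i)) ?_ ?_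
    · rw [Set.ofPred_forall]
      exact @MeasurableSet.iInter _ _ (nullExtension P m) _ _ fun l =>
        measurableSet_le (hθm l) (hθm i)
    · have hae : ∀ᵐ ω ∂P, ∀ i l, i ≠ l →
          theta α σ Y Z A i (t + 1) ω ≠ theta α σ Y Z A l (t + 1) ω := by
        rw [ae_all_iff]; intro i
        rw [ae_all_iff]; intro l
        by_cases hil : i = l
        · simp [hil]
        · simpa [hil, ae_iff] using htie (t + 1) (by simp) i l hil
      filter_upwards [hae] with ω hω
      have hmax := hA.arm_isMax ω (t + 1) (by omega)
      refine propext ⟨fun h l => ?_, fun h => ?_⟩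
      · have h' : A (t + 1) ω = i := h
        have := hmax l
        rwa [h'] at this
      · by_contra hne
        exact hω (A (t + 1) ω) i hne (le_antisymm (h _) (hmax i))

lemma measure_tie_eq_zero (hσ : 0 < σ) (hB : IsBandit P Y)
    (hA : IsBatchedThompsonSampling P α σ Y Z A) {t : ℕ} (ht : 1 ≤ t) {i l : Fin K} (hil : i ≠ l) :
    P {ω | theta α σ Y Z A i t ω = theta α σ Y Z A l t ω} = 0 := by
  induction t using Nat.strong_induction_on generalizing i l with
  | _ t ih =>
    obtain ⟨t, rfl⟩ := Nat.exists_eq_add_of_le' ht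
    have hcm := complNoise_le hB hA (i, t)
    have hIH := measurable_arm_of_no_tie hA t
      (fun s hs i l hil => ih s (Nat.lt_succ_of_le (Finset.mem_Icc.1 hs).2) (Finset.mem_Icc.1 hs).1
        hil) hcm (fun i s h1 _ => measurable_complNoise_reward h1 i)
      fun j s h1 h2 => measurable_complNoise_noise h1 (Or.inr (by simp only; omega))
    have hY' : ∀ j, ∀ s ∈ Finset.Icc 1 (t + 1 - 1),
        Measurable[nullExtension P (complNoise Y Z (i, t))] (Y j s) := fun j s hs =>
      (measurable_complNoise_reward (Finset.mem_Icc.1 hs).1 j).mono (le_nullExtension hcm) le_rfl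
    -- the mean and the standard deviation of the sample of the arm `i`
    set μ : Ω → ℝ := fun ω => sample α σ (fun s => A s ω) (fun l s => Y l s ω) i (t + 1) 0
    set c : Ω → ℝ := fun ω => √(σ ^ 2 / (1 + (cycleCount (fun s => A s ω) i
      (lastBatchEnd α (fun s => A s ω) (t + 1)) : ℝ)))
    have hc : ∀ ω, 0 < c ω := fun ω => Real.sqrt_pos.2 (by positivity)
    have hμm : Measurable[nullExtension P (complNoise Y Z (i, t))] μ :=
      measurable_sample (t := t + 1) (Z := fun _ _ _ => 0) hIH (hY' i) measurable_const
    have hcm' : Measurable[nullExtension P (complNoise Y Z (i, t))] c := by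
      have h := measurable_sample (t := t + 1) (α := α) (σ := σ) (i := i)
        (Z := fun _ _ _ => 1) hIH (hY' i) measurable_const
      convert h.sub hμm using 1
      ext ω
      simp [c, μ, sample]
    have hlm : Measurable[nullExtension P (complNoise Y Z (i, t))] (theta α σ Y Z A l (t + 1)) :=
      measurable_sample (t := t + 1) hIH (hY' l)
        ((measurable_complNoise_noise (by omega) (Or.inl (Ne.symm hil))).mono
          (le_nullExtension hcm) le_rfl)
    have hV : Measurable[nullExtension P (complNoise Y Z (i, t))]
        (fun ω => (theta α σ Y Z A l (t + 1) ω - μ ω) / c ω) := (hlm.sub hμm).div hcm'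
    have hz := measure_eq_zero_of_indepFun (hA.measurable_noise i (t + 1) (by omega))
      (hV.mono nullExtension_le le_rfl) (indepFun_of_indep (indep_complNoise hB hA (i, t)) hV)
      (by rw [hA.map_noise i (t + 1) (by omega)]; exact nullSingletonClass_gaussianReal (by simp))
    refine measure_mono_null (fun ω hω => ?_) hz
    have hω' : theta α σ Y Z A i (t + 1) ω = theta α σ Y Z A l (t + 1) ω := hω
    have e : theta α σ Y Z A i (t + 1) ω = μ ω + c ω * Z i (t + 1) ω := by
      simp [theta, μ, c, sample]
    simp only [Set.mem_ofPred_eq]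
    rw [eq_div_iff (hc ω).ne', ← hω', e]
    ring

/-- The samples have no ties, up to null sets. Hence the played arms are adapted, whatever the
tie-breaking rule may depend on. -/
lemma measurable_arm_nullExtension (hσ : 0 < σ) (hB : IsBandit P Y)
    (hA : IsBatchedThompsonSampling P α σ Y Z A) (t : ℕ)
    (hm : m ≤ mΩ) (hY : ∀ i s, 1 ≤ s → s < t → Measurable[m] (Y i s))
    (hZ : ∀ i s, 1 ≤ s → s ≤ t → Measurable[m] (Z i s)) :
    ∀ s ∈ Finset.Icc 1 t, Measurable[nullExtension P m] (A s) :=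
  measurable_arm_of_no_tie hA t
    (fun _ hs _ _ hil => measure_tie_eq_zero hσ hB hA (Finset.mem_Icc.1 hs).1 hil) hm hY hZ

end Adapted

/-! ### Tails of the standard normal distribution -/

section Gaussian

variable {Ω : Type*} {mΩ : MeasurableSpace Ω} {P : Measure Ω} {X : Ω → ℝ}

lemma hasSubgaussianMGF_of_map_eq (hX : Measurable X) (h : P.map X = gaussianReal 0 1) :
    HasSubgaussianMGF X 1 P where
  integrable_exp_mul t := by
    have := integrable_exp_mul_gaussianReal (μ := 0) (v := 1) t
    rw [← h] at this
    exact this.comp_measurable hX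
  mgf_le t := by rw [mgf_gaussianReal h]; simp

variable [IsProbabilityMeasure P]

lemma measure_le_gaussian (hX : Measurable X) (h : P.map X = gaussianReal 0 1) {u : ℝ}
    (hu : 0 ≤ u) : P {ω | u ≤ X ω} ≤ ENNReal.ofReal (Real.exp (-u ^ 2 / 2)) := by
  have := (hasSubgaussianMGF_of_map_eq hX h).measure_ge_le hu
  rw [← ofReal_measureReal]
  exact ENNReal.ofReal_le_ofReal (by simpa using this)

lemma measure_le_neg_gaussian (hX : Measurable X) (h : P.map X = gaussianReal 0 1) {u : ℝ}
    (hu : 0 ≤ u) : P {ω | X ω ≤ -u} ≤ ENNReal.ofReal (Real.exp (-u ^ 2 / 2)) := by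
  have := (hasSubgaussianMGF_of_map_eq hX h).neg.measure_ge_le hu
  rw [← ofReal_measureReal]
  refine ENNReal.ofReal_le_ofReal ?_
  simpa [le_neg] using this

lemma le_gaussianReal_Ioi {v w : ℝ} (hvw : v ≤ w) (hw : 0 ≤ w) :
    ENNReal.ofReal ((√(2 * Real.pi))⁻¹ * Real.exp (-(w + 1) ^ 2 / 2)) ≤
      gaussianReal 0 1 (Set.Ioi v) := by
  have hsub : Set.Ioc w (w + 1) ⊆ Set.Ioi v := fun x hx => hvw.trans_lt hx.1
  refine le_trans ?_ (measure_mono hsub)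
  rw [gaussianReal_apply 0 one_ne_zero]
  calc _ = ∫⁻ _ in Set.Ioc w (w + 1),
        ENNReal.ofReal ((√(2 * Real.pi))⁻¹ * Real.exp (-(w + 1) ^ 2 / 2)) := by simp
    _ ≤ _ := by
      refine setLIntegral_mono (by fun_prop) fun x hx => ?_
      rw [gaussianPDF, gaussianPDFReal_def]
      refine ENNReal.ofReal_le_ofReal ?_
      simp only [NNReal.coe_one, mul_one, sub_zero]
      gcongr
      · exact hw.trans hx.1.le
      · exact hx.2

end Gaussian

/-! ### Uniform deviation bound for the counted rewards -/

section Deviation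

variable {Ω : Type u} {K : ℕ}

/-- The exponent `l (S_i(t) - μ M_i(t)) - l² M_i(t) / 8` of the exponential supermartingale. -/
def exponent (μ l : ℝ) (Y : Fin K → ℕ → Ω → ℝ) (A : ℕ → Ω → Fin K) (i : Fin K) (t : ℕ) (ω : Ω) : ℝ :=
  l * (rewardSum (fun s => A s ω) (fun l s => Y l s ω) i t -
    μ * cycleCount (fun s => A s ω) i t) - l ^ 2 / 8 * cycleCount (fun s => A s ω) i t

variable {Y Z : Fin K → ℕ → Ω → ℝ} {m : MeasurableSpace Ω} [mΩ : MeasurableSpace Ω] {P : Measure Ω}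
  {A : ℕ → Ω → Fin K} {α σ μ l : ℝ} {i : Fin K}

omit mΩ in
open Classical in
lemma exponent_succ (t : ℕ) (ω : Ω) : exponent μ l Y A i (t + 1) ω = exponent μ l Y A i t ω +
    if A (t + 1) ω = i ∧ IsCycleEndpoint (fun s => A s ω) (t + 1) then
      l * (Y i (t + 1) ω - μ) - l ^ 2 / 8 else 0 := by
  rw [exponent, exponent, cycleCount_succ, rewardSum, rewardSum,
    Finset.sum_Icc_succ_top (by omega)]
  split_ifs <;> push_cast <;> ring

variable [NeZero K]

omit mΩ in
lemma measurable_exponent {t : ℕ} (hA : ∀ s ∈ Finset.Icc 1 t, Measurable[m] (A s))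
    (hY : ∀ s ∈ Finset.Icc 1 t, Measurable[m] (Y i s)) :
    Measurable[m] (exponent μ l Y A i t) := by
  have h1 := measurable_rewardSum_comp hA hY (τ := fun _ => t) (fun _ => le_rfl) fun _ _ _ => rfl
  have h2 : Measurable[m] fun ω => (cycleCount (fun s => A s ω) i t : ℝ) :=
    measurable_of_local hA (f := fun a => (cycleCount a i t : ℝ)) fun a a' h => by
      rw [cycleCount_congr h]
  exact ((h1.sub (h2.const_mul μ)).const_mul l).sub (h2.const_mul _)

variable [IsProbabilityMeasure P]

lemma lintegral_exp_le (hB : IsBandit P Y) (i : Fin K) {t : ℕ} (ht : 1 ≤ t) (l : ℝ) :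
    ∫⁻ ω, ENNReal.ofReal (Real.exp (l * (Y i t ω - meanReward P Y i) - l ^ 2 / 8)) ∂P ≤ 1 := by
  unfold meanReward
  have h := hasSubgaussianMGF_of_mem_Icc (hB.measurable i t ht).aemeasurable (hB.mem_Icc i t ht)
  rw [(hB.identDistrib i t ht).integral_eq] at h
  have hint := (h.integrable_exp_mul l).mul_const (Real.exp (-(l ^ 2 / 8)))
  have hmgf := h.mgf_le l
  rw [mgf] at hmgf
  simp_rw [sub_eq_add_neg _ (l ^ 2 / 8), Real.exp_add]
  rw [← ofReal_integral_eq_lintegral_ofReal hint (ae_of_all _ fun ω => by positivity),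
    integral_mul_const]
  refine ENNReal.ofReal_le_one.2 ?_
  refine (mul_le_mul_of_nonneg_right hmgf (Real.exp_pos _).le).trans ?_
  rw [← Real.exp_add, Real.exp_le_one_iff]
  simp
  linarith

variable (hσ : 0 < σ) (hB : IsBandit P Y) (hA : IsBatchedThompsonSampling P α σ Y Z A)
include hσ hB hA

lemma measurable_arm_complReward (t : ℕ) :
    ∀ s ∈ Finset.Icc 1 (t + 1), Measurable[nullExtension P (complReward Y Z t)] (A s) :=
  measurable_arm_nullExtension hσ hB hA (t + 1) (complReward_le hB hA t)
    (fun i _ h1 h2 => measurable_complReward_reward h1 h2.ne i)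
    fun i _ h1 _ => measurable_complReward_noise h1 i

lemma measurable_exponent_complReward {s t : ℕ} (hst : s ≤ t) :
    Measurable[nullExtension P (complReward Y Z t)] (exponent μ l Y A i s) :=
  measurable_exponent
    (fun r hr => measurable_arm_complReward hσ hB hA t r
      (Finset.Icc_subset_Icc_right (by omega) hr))
    fun r hr => (measurable_complReward_reward (Finset.mem_Icc.1 hr).1
      (by have := (Finset.mem_Icc.1 hr).2; omega) i).mono
      (le_nullExtension (complReward_le hB hA t)) le_rfl

lemma setLIntegral_exponent_succ_le {t : ℕ} {B : Set Ω}
    (hBm : MeasurableSet[nullExtension P (complReward Y Z t)] B) :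
    ∫⁻ ω in B, ENNReal.ofReal (Real.exp (exponent (meanReward P Y i) l Y A i (t + 1) ω)) ∂P ≤
      ∫⁻ ω in B, ENNReal.ofReal (Real.exp (exponent (meanReward P Y i) l Y A i t ω)) ∂P := by
  classical
  have hle : nullExtension P (complReward Y Z t) ≤ mΩ := nullExtension_le
  set D : Set Ω := {ω | A (t + 1) ω = i ∧ IsCycleEndpoint (fun s => A s ω) (t + 1)} with hD
  have hDm : MeasurableSet[nullExtension P (complReward Y Z t)] D :=
    measurableSet_of_local (measurable_arm_complReward hσ hB hA t)
      (p := fun a => a (t + 1) = i ∧ IsCycleEndpoint a (t + 1)) fun a a' h => by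
        rw [h (t + 1) (by simp), isCycleEndpoint_congr (by omega) h]
  set G : ℕ → Ω → ENNReal := fun t ω =>
    ENNReal.ofReal (Real.exp (exponent (meanReward P Y i) l Y A i t ω)) with hG
  set f : Ω → ENNReal := fun ω =>
    ENNReal.ofReal (Real.exp (l * (Y i (t + 1) ω - meanReward P Y i) - l ^ 2 / 8)) with hf
  have hGm : Measurable[nullExtension P (complReward Y Z t)] (G t) :=
    (measurable_exponent_complReward hσ hB hA le_rfl).exp.ennreal_ofReal
  rw [← lintegral_inter_add_sdiff (G (t + 1)) B (hle _ hDm),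
    ← lintegral_inter_add_sdiff (G t) B (hle _ hDm)]
  refine add_le_add ?_ (le_of_eq ?_)
  · have hBD : MeasurableSet[nullExtension P (complReward Y Z t)] (B ∩ D) :=
      @MeasurableSet.inter _ (_) _ _ hBm hDm
    have e : ∀ ω ∈ B ∩ D, G (t + 1) ω = G t ω * f ω := by
      intro ω hω
      have hω' : A (t + 1) ω = i ∧ IsCycleEndpoint (fun s => A s ω) (t + 1) := hω.2
      simp only [hG, hf]
      rw [exponent_succ, if_pos hω', Real.exp_add, ENNReal.ofReal_mul (Real.exp_pos _).le]
    rw [setLIntegral_congr_fun (hle _ hBD) e, ← lintegral_indicator (hle _ hBD)]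
    have hmul : (fun ω => (B ∩ D).indicator (fun ω => G t ω * f ω) ω) =
        fun ω => (B ∩ D).indicator (G t) ω * f ω := by
      ext ω; exact Set.indicator_mul_left _ _ _
    have hYm : Measurable fun (ω : Ω) (i : Fin K) => Y i (t + 1) ω :=
      measurable_pi_lambda _ fun i => hB.measurable i (t + 1) (by omega)
    have hfm : Measurable[MeasurableSpace.comap (fun (ω : Ω) (i : Fin K) => Y i (t + 1) ω)
        inferInstance] f :=
      ((((measurable_comap_apply (fun (ω : Ω) (i : Fin K) => Y i (t + 1) ω) i).sub_const
        _).const_mul l).sub_const _).exp.ennreal_ofReal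
    rw [hmul, lintegral_mul_eq_lintegral_mul_lintegral_of_independent_measurableSpace hle
      hYm.comap_le (indep_complReward hB hA t).symm (hGm.indicator hBD) hfm,
      lintegral_indicator (hle _ hBD)]
    exact mul_le_of_le_one_right' (lintegral_exp_le hB i (by omega) l)
  · refine setLIntegral_congr_fun ((hle _ hBm).diff (hle _ hDm)) fun ω hω => ?_
    have hω' : ¬ (A (t + 1) ω = i ∧ IsCycleEndpoint (fun s => A s ω) (t + 1)) := hω.2
    simp only [hG]
    rw [exponent_succ, if_neg hω', add_zero]

lemma measurableSet_exists_le_exponent (T : ℕ) (c : ℝ) :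
    MeasurableSet {ω | ∃ t ≤ T, c ≤ exponent μ l Y A i t ω} := by
  have : {ω | ∃ t ≤ T, c ≤ exponent μ l Y A i t ω} = ⋃ t ∈ Finset.range (T + 1),
      {ω | c ≤ exponent μ l Y A i t ω} := by
    ext ω; simp
  rw [this]
  exact Finset.measurableSet_biUnion _ fun t _ => measurableSet_le measurable_const
    ((measurable_exponent_complReward hσ hB hA le_rfl).mono nullExtension_le le_rfl)

/-- Ville's inequality for the exponential supermartingale of the counted rewards: a Hoeffding bound
that holds for all times simultaneously, and hence for all values of the cycle count. -/
lemma measure_exists_le_exponent (T : ℕ) (c : ℝ) :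
    P {ω | ∃ t ≤ T, c ≤ exponent (meanReward P Y i) l Y A i t ω} ≤
      ENNReal.ofReal (Real.exp (-c)) := by
  rcases le_or_gt c 0 with hc | hc
  · refine prob_le_one.trans (ENNReal.one_le_ofReal.2 ?_)
    exact Real.one_le_exp (by linarith)
  set E : ℕ → Ω → ℝ := exponent (meanReward P Y i) l Y A i with hE
  set H : ℕ → Set Ω := fun t => {ω | ∃ s ≤ t, c ≤ E s ω} with hH
  have hHm : ∀ t, MeasurableSet[nullExtension P (complReward Y Z t)] (H t) := by
    intro t
    have : H t = ⋃ s ∈ Finset.range (t + 1), {ω | c ≤ E s ω} := by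
      ext ω; simp [hH]
    rw [this]
    refine @Finset.measurableSet_biUnion _ _ (_) _ _ fun s hs => ?_
    exact measurableSet_le measurable_const (measurable_exponent_complReward hσ hB hA
      (Nat.lt_succ_iff.1 (Finset.mem_range.1 hs)))
  have hHm' : ∀ t, MeasurableSet (H t) := fun t => nullExtension_le _ (hHm t)
  have hEm : ∀ t, Measurable (E t) := fun t =>
    (measurable_exponent_complReward hσ hB hA (le_refl t)).mono nullExtension_le le_rfl
  have key : ∀ t, ENNReal.ofReal (Real.exp c) * P (H t) +
      ∫⁻ ω in (H t)ᶜ, ENNReal.ofReal (Real.exp (E t ω)) ∂P ≤ 1 := by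
    intro t
    induction t with
    | zero =>
      have hE0 : ∀ ω, E 0 ω = 0 := by intro ω; simp [hE, exponent, rewardSum]
      have h0 : H 0 = ∅ := by
        ext ω; simp [hH, hE0, hc]
      simp [h0, hE0]
    | succ t ih =>
      refine le_trans ?_ ih
      have hsub : H t ⊆ H (t + 1) := fun ω ⟨s, hs, h⟩ => ⟨s, by omega, h⟩
      have hdiff : MeasurableSet (H (t + 1) \ H t) := (hHm' _).diff (hHm' _)
      have hstep := setLIntegral_exponent_succ_le hσ hB hA (i := i) (l := l)
        (@MeasurableSet.compl _ _ (_) (hHm t))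
      have hP : P (H (t + 1)) = P (H t) + P (H (t + 1) \ H t) := by
        rw [← measure_union Set.disjoint_sdiff_right hdiff, Set.union_sdiff_cancel hsub]
      rw [hP, mul_add, add_assoc]
      refine add_le_add le_rfl (le_trans ?_ hstep)
      rw [← lintegral_inter_add_sdiff _ (H t)ᶜ (hHm' (t + 1))]
      have e1 : (H t)ᶜ ∩ H (t + 1) = H (t + 1) \ H t := by rw [Set.inter_comm]; rfl
      have e2 : (H t)ᶜ \ H (t + 1) = (H (t + 1))ᶜ := by
        ext ω
        simp only [Set.mem_sdiff, Set.mem_compl_iff]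
        exact ⟨fun h => h.2, fun h => ⟨fun h' => h (hsub h'), h⟩⟩
      rw [e1, e2]
      refine add_le_add ?_ le_rfl
      rw [← setLIntegral_const]
      refine setLIntegral_mono (hEm (t + 1)).exp.ennreal_ofReal fun ω hω => ?_
      obtain ⟨⟨s, hs, h⟩, hn⟩ := hω
      have : s = t + 1 := by
        by_contra hne
        exact hn ⟨s, by omega, h⟩
      subst this
      exact ENNReal.ofReal_le_ofReal (Real.exp_le_exp.2 h)
  have h1 := (le_add_right le_rfl).trans (key T)
  rw [Real.exp_neg, ENNReal.ofReal_inv_of_pos (Real.exp_pos c)]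
  rw [mul_comm] at h1
  exact ENNReal.le_inv_iff_mul_le.2 h1

end Deviation

/-! ### Counting plays while few observations are available -/

section Paths

variable {K : ℕ} {a : ℕ → Fin K} {α L : ℝ}

/-- Times that are bounded in number by the cycle count of the arm `l` are at most `α L + 1` as long
as the current batch began with fewer than `L` counted steps of that arm. -/
lemma card_le_of_cycleCount_lt (hα : 1 < α) (hL : 0 ≤ L) (l : Fin K) {p : ℕ → Prop}
    [DecidablePred p]
    (hp : ∀ t, (∑ s ∈ Finset.Icc 1 t, if p s then 1 else 0) ≤ cycleCount a l t) (T : ℕ) :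
    ((∑ t ∈ Finset.Icc 1 T,
      if p t ∧ (cycleCount a l (lastBatchEnd α a t) : ℝ) < L then 1 else 0 : ℕ) : ℝ) ≤
        α * L + 1 := by
  induction T with
  | zero => simp; positivity
  | succ T ih =>
    by_cases h : p (T + 1) ∧ (cycleCount a l (lastBatchEnd α a (T + 1)) : ℝ) < L
    · have h1 : (∑ t ∈ Finset.Icc 1 (T + 1),
          if p t ∧ (cycleCount a l (lastBatchEnd α a t) : ℝ) < L then 1 else 0) ≤
          cycleCount a l (T + 1) := by
        refine le_trans (Finset.sum_le_sum fun t _ => ?_) (hp (T + 1))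
        split_ifs <;> simp_all
      have h2 := cycleCount_le (a := a) hα l (Nat.succ_le_succ T.zero_le)
      have h3 := mul_le_mul_of_nonneg_left h.2.le (by linarith : 0 ≤ α)
      exact (Nat.cast_le.2 h1).trans (by linarith)
    · rw [Finset.sum_Icc_succ_top (by omega), if_neg h, add_zero]
      exact ih

open Classical in
/-- Each value of the cycle count is attained at one counted step only. -/
lemma card_cycleCount_eq_le_one (a : ℕ → Fin K) (l : Fin K) (n T : ℕ) :
    (∑ t ∈ Finset.Icc 1 T,
      if a t = l ∧ IsCycleEndpoint a t ∧ cycleCount a l t = n then 1 else 0) ≤ 1 := by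
  have key : (∑ t ∈ Finset.Icc 1 T,
      if a t = l ∧ IsCycleEndpoint a t ∧ cycleCount a l t = n then 1 else 0) ≤
      if n ≤ cycleCount a l T then 1 else 0 := by
    induction T with
    | zero => simp
    | succ T ih =>
      rw [Finset.sum_Icc_succ_top (by omega)]
      have := cycleCount_succ a l T
      grind
  exact key.trans (by split_ifs <;> simp)

/-- A step with the arm `l` is counted if it begins a cycle or follows a step with another arm. -/
lemma isCycleEndpoint_of_switch {l : Fin K} {t : ℕ} (ht : 1 ≤ t)
    (h : IsBoundary a (t - 1) ∨ a (t - 1) ≠ l) (hl : a t = l) : IsCycleEndpoint a t := by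
  obtain ⟨t, rfl⟩ := Nat.exists_eq_add_of_le' ht
  rw [isCycleEndpoint_succ_iff]
  have := isBoundary_succ (a := a) (t := t)
  simp only [Nat.add_sub_cancel] at h
  grind

end Paths

/-! ### Inverse probability weighting -/

lemma lintegral_inv_measure_Ioi {Ω : Type*} {m mΩ : MeasurableSpace Ω} {P : Measure Ω}
    [IsProbabilityMeasure P] {X v : Ω → ℝ} {W : Set Ω} (hm : m ≤ mΩ) (hX : Measurable X)
    (hv : Measurable[m] v) (hW : MeasurableSet[m] W)
    (hind : Indep (MeasurableSpace.comap X inferInstance) m P)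
    (hpos : ∀ x, P.map X (Set.Ioi x) ≠ 0) :
    ∫⁻ ω, (W ∩ {ω | v ω < X ω}).indicator (fun ω => (P.map X (Set.Ioi (v ω)))⁻¹) ω ∂P = P W := by
  have : IsProbabilityMeasure (P.map X) := Measure.isProbabilityMeasure_map hX.aemeasurable
  have hanti : Antitone fun x => P.map X (Set.Ioi x) := fun x y h =>
    measure_mono (Set.Ioi_subset_Ioi h)
  have hD : MeasurableSet {q : (ENNReal × ℝ) × ℝ | q.1.2 < q.2} :=
    measurableSet_lt measurable_fst.snd measurable_snd
  have hV : Measurable[m] fun ω => (W.indicator (1 : Ω → ENNReal) ω, v ω) :=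
    ((measurable_const (a := (1 : ENNReal))).indicator hW).prodMk hv
  have h := lintegral_indepFun hX (hV.mono hm le_rfl) (indepFun_of_indep hind hV)
    (f := fun q => q.1.1 * (P.map X (Set.Ioi q.1.2))⁻¹ *
      {q : (ENNReal × ℝ) × ℝ | q.1.2 < q.2}.indicator 1 q)
    ((measurable_fst.fst.mul (hanti.measurable.comp measurable_fst.snd).inv).mul
      (measurable_one.indicator hD))
  have hlhs : ∀ ω, (W ∩ {ω | v ω < X ω}).indicator (fun ω => (P.map X (Set.Ioi (v ω)))⁻¹) ω =
      W.indicator (1 : Ω → ENNReal) ω * (P.map X (Set.Ioi (v ω)))⁻¹ *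
        {q : (ENNReal × ℝ) × ℝ | q.1.2 < q.2}.indicator 1
          ((W.indicator (1 : Ω → ENNReal) ω, v ω), X ω) := by
    intro ω
    by_cases h1 : ω ∈ W <;> by_cases h2 : v ω < X ω <;> simp [Set.indicator, h1, h2]
  simp_rw [hlhs]
  rw [h, ← lintegral_indicator_one (hm _ hW)]
  refine lintegral_congr fun ω => ?_
  have hin : ∀ x, {q : (ENNReal × ℝ) × ℝ | q.1.2 < q.2}.indicator
      (1 : (ENNReal × ℝ) × ℝ → ENNReal)
      ((W.indicator (1 : Ω → ENNReal) ω, v ω), x) = (Set.Ioi (v ω)).indicator 1 x := fun x => rfl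
  simp_rw [hin]
  rw [lintegral_const_mul _ (measurable_one.indicator measurableSet_Ioi),
    lintegral_indicator_one measurableSet_Ioi, mul_assoc,
    ENNReal.inv_mul_cancel (hpos _) (measure_ne_top _ _), mul_one]

/-! ### Underestimation of the optimal arm -/

section Optimal

/-- The weight `1 / p` of a state in which the optimal arm has `k` counted steps and reward deficit
at most `D` is of order `exp (D² / n)` for all `n ≤ α (k + 1)`. The condition on `α` makes the
exponent smaller than the one in Hoeffding's inequality, `2 D² / n`. -/
lemma inv_gaussianReal_Ioi_le {α σ v D k n : ℝ} (hσ : 0 < σ)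
    (hασ : α ≤ 5 * σ ^ 2 / 4) (hD : 0 ≤ D) (hk : 0 ≤ k) (hn : 1 ≤ n) (hnk : n ≤ α * (k + 1))
    (hv : v * √(σ ^ 2 / (1 + k)) ≤ (1 + D) / (1 + k)) :
    (gaussianReal 0 1 (Set.Ioi v))⁻¹ ≤
      ENNReal.ofReal (√(2 * Real.pi) * Real.exp 7 * Real.exp (D ^ 2 / n)) := by
  set w : ℝ := √((1 + D) ^ 2 / ((1 + k) * σ ^ 2)) with hw
  have hk1 : 0 < 1 + k := by linarith
  have hvw : v ≤ w := by
    have hs : 0 < √(σ ^ 2 / (1 + k)) := Real.sqrt_pos.2 (by positivity)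
    rw [← mul_le_mul_iff_left₀ hs]
    refine hv.trans (le_of_eq ?_)
    rw [hw, ← Real.sqrt_mul (by positivity)]
    symm
    rw [Real.sqrt_eq_iff_mul_self_eq (by positivity) (by positivity)]
    field_simp
  have hw2 : w ^ 2 = (1 + D) ^ 2 / ((1 + k) * σ ^ 2) := Real.sq_sqrt (by positivity)
  have hn0 : 0 < n := by linarith
  have hw3 : w ^ 2 ≤ 5 / 4 * (1 + D) ^ 2 / n := by
    rw [hw2, div_le_div_iff₀ (by positivity) hn0]
    have : n ≤ 5 / 4 * ((1 + k) * σ ^ 2) := by nlinarith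
    nlinarith [mul_le_mul_of_nonneg_left this (sq_nonneg (1 + D))]
  have hexp : (w + 1) ^ 2 / 2 ≤ 7 + D ^ 2 / n := by
    have h1 : (w + 1) ^ 2 ≤ 5 / 4 * w ^ 2 + 5 := by nlinarith [sq_nonneg (w - 4)]
    have h2 : (1 + D) ^ 2 ≤ 5 / 4 * D ^ 2 + 5 := by nlinarith [sq_nonneg (D - 4)]
    have h3 : 5 / 4 * (1 + D) ^ 2 / n ≤ 25 / 16 * (D ^ 2 / n) + 25 / 4 := by
      rw [div_le_iff₀ hn0, add_mul, mul_assoc, div_mul_cancel₀ _ hn0.ne']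
      nlinarith
    have h4 : 0 ≤ D ^ 2 / n := by positivity
    linarith
  rw [ENNReal.inv_le_iff_inv_le, ← ENNReal.ofReal_inv_of_pos (by positivity)]
  refine le_trans (ENNReal.ofReal_le_ofReal ?_) (le_gaussianReal_Ioi hvw (Real.sqrt_nonneg _))
  rw [mul_assoc, ← Real.exp_add, mul_inv, ← Real.exp_neg]
  gcongr
  linarith

variable {Ω : Type u} {K : ℕ} [NeZero K] {Y Z : Fin K → ℕ → Ω → ℝ} [mΩ : MeasurableSpace Ω]
  {P : Measure Ω} {A : ℕ → Ω → Fin K} {α σ : ℝ}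

/-- An event in terms of the exponent of the supermartingale that contains the event that the deficit
of the counted rewards of the optimal arm reaches `√(r n)` while its cycle count is at most `n`. -/
def deficitEvent (P : Measure Ω) (Y : Fin K → ℕ → Ω → ℝ) (A : ℕ → Ω → Fin K) (T n r : ℕ) : Set Ω :=
  {ω | ∃ t ≤ T, (2 * r : ℝ) ≤ exponent (meanReward P Y 0) (-(4 * √(r / n))) Y A 0 t ω}

/-- An upper bound for `exp (D² / n)`, where `D` is the largest deficit of the counted
rewards of the optimal arm while its cycle count is at most `n`. -/
def deficitWeight (P : Measure Ω) (Y : Fin K → ℕ → Ω → ℝ) (A : ℕ → Ω → Fin K) (T n : ℕ) (ω : Ω) :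
    ENNReal :=
  ∑' r : ℕ, (deficitEvent P Y A T n r).indicator
    (fun _ => ENNReal.ofReal (Real.exp (r + 1))) ω

/-- The constant `∑ exp (1 - r)` that bounds the mean of `deficitWeight`. -/
def deficitConst : ℝ := ∑' r : ℕ, Real.exp (1 - r)

lemma summable_exp_one_sub : Summable fun r : ℕ => Real.exp (1 - r) := by
  simp_rw [sub_eq_add_neg, Real.exp_add]
  exact Real.summable_exp_neg_nat.mul_left _

lemma deficitConst_nonneg : 0 ≤ deficitConst := tsum_nonneg fun _ => (Real.exp_pos _).le

lemma exp_le_deficitWeight {T n t : ℕ} {ω : Ω} (hn : 1 ≤ n) (ht : t ≤ T)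
    (hc : cycleCount (fun s => A s ω) 0 t ≤ n) {D : ℝ} (hD : D =
      max 0 (meanReward P Y 0 * cycleCount (fun s => A s ω) 0 t -
        rewardSum (fun s => A s ω) (fun l s => Y l s ω) 0 t)) :
    ENNReal.ofReal (Real.exp (D ^ 2 / n)) ≤ deficitWeight P Y A T n ω := by
  have hn0 : (0 : ℝ) < n := by exact_mod_cast hn
  have hD0 : 0 ≤ D := hD ▸ le_max_left _ _
  set r : ℕ := ⌊D ^ 2 / n⌋₊ with hr
  have hr1 : (r : ℝ) ≤ D ^ 2 / n := Nat.floor_le (by positivity)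
  have hmem : ω ∈ deficitEvent P Y A T n r := by
    refine ⟨t, ht, ?_⟩
    rw [exponent]
    set X := meanReward P Y 0 * cycleCount (fun s => A s ω) 0 t -
      rewardSum (fun s => A s ω) (fun l s => Y l s ω) 0 t with hX
    have hcr : (cycleCount (fun s => A s ω) 0 t : ℝ) ≤ n := by exact_mod_cast hc
    have hq : √((r : ℝ) / n) ^ 2 = r / n := Real.sq_sqrt (by positivity)
    have hq0 : 0 ≤ √((r : ℝ) / n) := Real.sqrt_nonneg _
    have h1 : (r : ℝ) / n * cycleCount (fun s => A s ω) 0 t ≤ r := by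
      rw [div_mul_eq_mul_div, div_le_iff₀ hn0]
      exact mul_le_mul_of_nonneg_left hcr (by positivity)
    have h2 : (r : ℝ) ≤ √((r : ℝ) / n) * X := by
      rcases Nat.eq_zero_or_pos r with h0 | hpos
      · simp [h0]
      · have hDpos : 0 < D := by
          by_contra hcon
          have : D = 0 := le_antisymm (not_lt.1 hcon) hD0
          simp [hr, this] at hpos
        have hDX : D = X := by
          rcases max_choice 0 X with h | h
          · rw [h] at hD; linarith
          · rw [h] at hD; exact hD
        rw [← hDX]
        have h3 : √((r : ℝ) / n) * n ≤ D := by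
          rw [← abs_of_nonneg hD0, ← abs_of_nonneg (mul_nonneg hq0 hn0.le)]
          refine sq_le_sq.1 ?_
          rw [mul_pow, hq]
          rw [le_div_iff₀ hn0] at hr1
          calc (r : ℝ) / n * n ^ 2 = r * n := by field_simp
            _ ≤ D ^ 2 := hr1
        calc (r : ℝ) = √((r : ℝ) / n) * (√((r : ℝ) / n) * n) := by
              rw [← mul_assoc, ← sq, hq]; field_simp
          _ ≤ _ := mul_le_mul_of_nonneg_left h3 hq0
    have e : -(4 * √((r : ℝ) / n)) * (rewardSum (fun s => A s ω) (fun l s => Y l s ω) 0 t -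
        meanReward P Y 0 * cycleCount (fun s => A s ω) 0 t) -
        (-(4 * √((r : ℝ) / n))) ^ 2 / 8 * cycleCount (fun s => A s ω) 0 t =
        4 * (√((r : ℝ) / n) * X) - 2 * (√((r : ℝ) / n) ^ 2 * cycleCount (fun s => A s ω) 0 t) := by
      rw [hX]; ring
    rw [e, hq]
    linarith
  refine le_trans ?_ (ENNReal.le_tsum r)
  rw [Set.indicator_of_mem hmem]
  exact ENNReal.ofReal_le_ofReal (Real.exp_le_exp.2 (Nat.lt_floor_add_one _).le)

variable [IsProbabilityMeasure P]

lemma measurableSet_deficitEvent (hσ : 0 < σ) (hB : IsBandit P Y)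
    (hA : IsBatchedThompsonSampling P α σ Y Z A) (T n r : ℕ) :
    MeasurableSet (deficitEvent P Y A T n r) :=
  measurableSet_exists_le_exponent hσ hB hA T _

lemma measurable_deficitWeight (hσ : 0 < σ) (hB : IsBandit P Y)
    (hA : IsBatchedThompsonSampling P α σ Y Z A) (T n : ℕ) :
    Measurable (deficitWeight P Y A T n) :=
  Measurable.tsum fun r =>
    measurable_const.indicator (measurableSet_deficitEvent hσ hB hA T n r)

lemma lintegral_deficitWeight_le (hσ : 0 < σ) (hB : IsBandit P Y)
    (hA : IsBatchedThompsonSampling P α σ Y Z A) (T n : ℕ) :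
    ∫⁻ ω, deficitWeight P Y A T n ω ∂P ≤ ENNReal.ofReal deficitConst := by
  have hm := measurableSet_deficitEvent hσ hB hA T n
  unfold deficitWeight
  rw [lintegral_tsum fun r => (measurable_const.indicator (hm r)).aemeasurable, deficitConst,
    ENNReal.ofReal_tsum_of_nonneg (fun r => (Real.exp_pos _).le) summable_exp_one_sub]
  refine ENNReal.tsum_le_tsum fun r => ?_
  rw [lintegral_indicator_const (hm r)]
  refine (mul_le_mul_right (measure_exists_le_exponent hσ hB hA T (2 * r)) _).trans ?_
  rw [← ENNReal.ofReal_mul (Real.exp_pos _).le, ← Real.exp_add]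
  refine ENNReal.ofReal_le_ofReal (Real.exp_le_exp.2 ?_)
  linarith

end Optimal

section Exploration

variable {Ω : Type u} {K : ℕ} [NeZero K] {Y Z : Fin K → ℕ → Ω → ℝ} [mΩ : MeasurableSpace Ω]
  {P : Measure Ω} {A : ℕ → Ω → Fin K} {α σ L y : ℝ}

lemma meanReward_mem_Icc [IsProbabilityMeasure P] (hB : IsBandit P Y) (i : Fin K) :
    meanReward P Y i ∈ Set.Icc (0 : ℝ) 1 := by
  have h := hB.mem_Icc i 1 le_rfl
  refine ⟨integral_nonneg_of_ae (h.mono fun ω hω => hω.1), ?_⟩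
  have := integral_mono_ae (Integrable.of_mem_Icc 0 1 (hB.measurable i 1 le_rfl).aemeasurable h)
    (integrable_const (1 : ℝ)) (h.mono fun ω hω => hω.2)
  rw [meanReward]
  simpa using this

/-- All suboptimal arms have samples at most `y`, the optimal arm would be counted if it were
played, and it had fewer than `L` counted steps at the start of the batch. -/
def explorationEvent (α σ L y : ℝ) (Y Z : Fin K → ℕ → Ω → ℝ) (A : ℕ → Ω → Fin K) (t : ℕ) : Set Ω :=
  {ω | (IsBoundary (fun s => A s ω) (t - 1) ∨ A (t - 1) ω ≠ 0) ∧
    (cycleCount (fun s => A s ω) 0 (lastBatchEnd α (fun s => A s ω) t) : ℝ) < L ∧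
    ∀ l, l ≠ 0 → theta α σ Y Z A l t ω ≤ y}

/-- The threshold that the noise of the optimal arm must exceed for its sample to exceed `y`. -/
def noiseThreshold (α σ y : ℝ) (Y : Fin K → ℕ → Ω → ℝ) (A : ℕ → Ω → Fin K) (t : ℕ) (ω : Ω) : ℝ :=
  (y - rewardSum (fun s => A s ω) (fun l s => Y l s ω) 0 (lastBatchEnd α (fun s => A s ω) t) /
    (1 + (cycleCount (fun s => A s ω) 0 (lastBatchEnd α (fun s => A s ω) t) : ℝ))) /
  √(σ ^ 2 / (1 + (cycleCount (fun s => A s ω) 0 (lastBatchEnd α (fun s => A s ω) t) : ℝ)))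

omit mΩ in
lemma noiseThreshold_lt_iff (hσ : 0 < σ) {t : ℕ} {ω : Ω} :
    noiseThreshold α σ y Y A t ω < Z 0 t ω ↔ y < theta α σ Y Z A 0 t ω := by
  rw [noiseThreshold, div_lt_iff₀ (Real.sqrt_pos.2 (by positivity)), theta, sample, sub_lt_iff_lt_add',
    mul_comm]

lemma measurableSet_explorationEvent_and_measurable_noiseThreshold [IsProbabilityMeasure P]
    (hσ : 0 < σ) (hB : IsBandit P Y) (hA : IsBatchedThompsonSampling P α σ Y Z A) (t : ℕ) :
    MeasurableSet[nullExtension P (complNoise Y Z (0, t))]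
        (explorationEvent α σ L y Y Z A (t + 1)) ∧
      Measurable[nullExtension P (complNoise Y Z (0, t))]
        (noiseThreshold α σ y Y A (t + 1)) := by
  have hcm := complNoise_le hB hA (0, t)
  have hAm := measurable_arm_nullExtension hσ hB hA t hcm
    (fun i s h1 _ => measurable_complNoise_reward h1 i)
    fun j s h1 h2 => measurable_complNoise_noise h1 (Or.inr (by simp only; omega))
  have hY : ∀ j, ∀ s ∈ Finset.Icc 1 t,
      Measurable[nullExtension P (complNoise Y Z (0, t))] (Y j s) := fun j s hs =>
    (measurable_complNoise_reward (Finset.mem_Icc.1 hs).1 j).mono (le_nullExtension hcm) le_rfl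
  have hcount : Measurable[nullExtension P (complNoise Y Z (0, t))] fun ω =>
      (cycleCount (fun s => A s ω) 0 (lastBatchEnd α (fun s => A s ω) (t + 1)) : ℝ) :=
    measurable_of_local hAm
      (f := fun a => (cycleCount a 0 (lastBatchEnd α a (t + 1)) : ℝ)) fun a a' h => by
        rw [lastBatchEnd_congr (t := t + 1) h, cycleCount_congr fun s hs => h s
          (Finset.Icc_subset_Icc_right (lastBatchEnd_le α a' (t + 1)) hs)]
  have hsum := measurable_rewardSum_comp hAm (hY 0) (τ := fun a => lastBatchEnd α a (t + 1))
    (fun a => lastBatchEnd_le α a (t + 1)) fun a a' h => lastBatchEnd_congr (t := t + 1) h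
  refine ⟨?_, ?_⟩
  · refine @MeasurableSet.inter _ (_) _ _ ?_ (@MeasurableSet.inter _ (_) _ _
      (measurableSet_lt hcount measurable_const) ?_)
    · refine measurableSet_of_local hAm (p := fun a => IsBoundary a (t + 1 - 1) ∨ a (t + 1 - 1) ≠ 0)
        fun a a' h => ?_
      simp only [Nat.add_sub_cancel]
      rcases Nat.eq_zero_or_pos t with rfl | ht
      · simp [isBoundary_zero]
      · rw [isBoundary_congr h, h t (Finset.mem_Icc.2 ⟨ht, le_rfl⟩)]
    · have : {ω | ∀ l, l ≠ 0 → theta α σ Y Z A l (t + 1) ω ≤ y} =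
          ⋂ l ∈ Finset.univ.erase (0 : Fin K), {ω | theta α σ Y Z A l (t + 1) ω ≤ y} := by
        ext ω; simp
      change MeasurableSet[nullExtension P (complNoise Y Z (0, t))]
        {ω | ∀ l, l ≠ 0 → theta α σ Y Z A l (t + 1) ω ≤ y}
      rw [this]
      refine @Finset.measurableSet_biInter _ _ (_) _ _ fun l hl => ?_
      refine measurableSet_le (measurable_sample (t := t + 1) hAm (hY l) ?_) measurable_const
      exact (measurable_complNoise_noise (by omega) (Or.inl (Finset.ne_of_mem_erase hl))).mono
        (le_nullExtension hcm) le_rfl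
  · exact (measurable_const.sub (hsum.div (hcount.const_add 1))).div
      (measurable_const.div (hcount.const_add 1)).sqrt

open Classical in
/-- The comparison of Agrawal and Goyal: whenever all other samples are at most `y`, the optimal arm
is played as soon as its own sample exceeds `y`, which has probability `p` given the past. So the
exploration event is paid for, with the factor `1 / p`, by counted steps of the optimal arm. -/
lemma measure_explorationEvent_le [IsProbabilityMeasure P] (hα : 1 < α) (hσ : 0 < σ)
    (hασ : α ≤ 5 * σ ^ 2 / 4) (hB : IsBandit P Y) (hA : IsBatchedThompsonSampling P α σ Y Z A)
    (hy : y ≤ meanReward P Y 0) {t T : ℕ} (ht : 1 ≤ t) (htT : t ≤ T) :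
    P (explorationEvent α σ L y Y Z A t) ≤
      ∫⁻ ω, ∑ n ∈ Finset.Icc 1 ⌊α * L + 1⌋₊,
        (if A t ω = 0 ∧ IsCycleEndpoint (fun s => A s ω) t ∧ cycleCount (fun s => A s ω) 0 t = n
          then 1 else 0) *
        (ENNReal.ofReal (√(2 * Real.pi) * Real.exp 7) * deficitWeight P Y A T n ω) ∂P := by
  obtain ⟨t, rfl⟩ := Nat.exists_eq_add_of_le' ht
  obtain ⟨hW, hv⟩ := measurableSet_explorationEvent_and_measurable_noiseThreshold
    (L := L) (y := y) hσ hB hA t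
  have hmap := hA.map_noise 0 (t + 1) ht
  rw [← lintegral_inv_measure_Ioi nullExtension_le (hA.measurable_noise 0 (t + 1) ht) hv hW
    (indep_complNoise hB hA (0, t)) (fun x => by
      rw [hmap]
      refine ne_of_gt (lt_of_lt_of_le ?_ (le_gaussianReal_Ioi (le_max_left x 0) (le_max_right x 0)))
      exact ENNReal.ofReal_pos.2 (by positivity))]
  refine lintegral_mono fun ω => ?_
  refine Set.indicator_apply_le' (fun hω => ?_) fun _ => zero_le
  obtain ⟨⟨hH, hkL, hθ⟩, hlt⟩ := hω
  have hlt' : y < theta α σ Y Z A 0 (t + 1) ω := (noiseThreshold_lt_iff hσ).1 hlt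
  -- the optimal arm has the strictly largest sample
  have hA0 : A (t + 1) ω = 0 := by
    by_contra hne
    have h1 : theta α σ Y Z A 0 (t + 1) ω ≤ theta α σ Y Z A (A (t + 1) ω) (t + 1) ω :=
      hA.arm_isMax ω (t + 1) ht 0
    exact absurd (hθ _ hne) (not_le.2 (hlt'.trans_le h1))
  have hend := isCycleEndpoint_of_switch ht hH hA0
  set a : ℕ → Fin K := fun s => A s ω with ha
  have hcount : cycleCount a 0 (t + 1) = cycleCount a 0 t + 1 := by
    rw [cycleCount_succ, if_pos ⟨hA0, hend⟩]
  have hkle : cycleCount a 0 (lastBatchEnd α a (t + 1)) ≤ cycleCount a 0 (t + 1) :=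
    cycleCount_lastBatchEnd_le 0 (t + 1)
  have hcle := cycleCount_le (a := a) hα 0 ht
  have hn1 : 1 ≤ cycleCount a 0 (t + 1) := by omega
  have hnN : cycleCount a 0 (t + 1) ∈ Finset.Icc 1 ⌊α * L + 1⌋₊ := by
    refine Finset.mem_Icc.2 ⟨hn1, Nat.le_floor (hcle.trans ?_)⟩
    have := mul_le_mul_of_nonneg_left hkL.le (by linarith : 0 ≤ α)
    linarith
  refine le_trans ?_ (Finset.single_le_sum (fun _ _ => zero_le) hnN)
  rw [if_pos ⟨hA0, hend, rfl⟩, one_mul, hmap]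
  set k : ℝ := ((cycleCount a 0 (lastBatchEnd α a (t + 1)) : ℕ) : ℝ) with hk
  set D : ℝ := max 0 (meanReward P Y 0 * k -
    rewardSum a (fun l s => Y l s ω) 0 (lastBatchEnd α a (t + 1))) with hD
  have hk0 : 0 ≤ k := by positivity
  have hμ := (meanReward_mem_Icc hB 0).2
  have hinv : (gaussianReal 0 1 (Set.Ioi (noiseThreshold α σ y Y A (t + 1) ω)))⁻¹ ≤
      ENNReal.ofReal (√(2 * Real.pi) * Real.exp 7 *
        Real.exp (D ^ 2 / cycleCount a 0 (t + 1))) := by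
    refine inv_gaussianReal_Ioi_le (k := k) hσ hασ (le_max_left _ _) hk0
      (by exact_mod_cast hn1) (by linarith) ?_
    rw [noiseThreshold, div_mul_cancel₀ _ (Real.sqrt_pos.2 (by positivity)).ne',
      le_div_iff₀ (by positivity), sub_mul, div_mul_cancel₀ _ (by positivity)]
    have h1 := le_max_right 0 (meanReward P Y 0 * k -
      rewardSum a (fun l s => Y l s ω) 0 (lastBatchEnd α a (t + 1)))
    have h2 := mul_le_mul_of_nonneg_right hy (by linarith : 0 ≤ 1 + k)
    linarith
  refine hinv.trans ?_
  rw [ENNReal.ofReal_mul (by positivity)]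
  refine mul_le_mul_right (exp_le_deficitWeight hn1 (t := lastBatchEnd α a (t + 1)) ?_ hkle hD) _
  exact (lastBatchEnd_le α a (t + 1)).trans (by omega)

lemma sum_measure_explorationEvent_le [IsProbabilityMeasure P] (hα : 1 < α) (hσ : 0 < σ)
    (hασ : α ≤ 5 * σ ^ 2 / 4) (hB : IsBandit P Y) (hA : IsBatchedThompsonSampling P α σ Y Z A)
    (hy : y ≤ meanReward P Y 0) (hL : 0 ≤ L) (T : ℕ) :
    ∑ t ∈ Finset.Icc 1 T, P (explorationEvent α σ L y Y Z A t) ≤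
      ENNReal.ofReal ((α * L + 1) * (√(2 * Real.pi) * Real.exp 7 * deficitConst)) := by
  classical
  set g : ℕ → Ω → ENNReal := fun n ω =>
    ENNReal.ofReal (√(2 * Real.pi) * Real.exp 7) * deficitWeight P Y A T n ω with hg
  have hgm : ∀ n, Measurable (g n) := fun n => (measurable_deficitWeight hσ hB hA T n).const_mul _
  set S : ℕ → ℕ → Set Ω := fun t n => {ω | A t ω = 0 ∧ IsCycleEndpoint (fun s => A s ω) t ∧
    cycleCount (fun s => A s ω) 0 t = n} with hS
  have hSm : ∀ t ∈ Finset.Icc 1 T, ∀ n, MeasurableSet (S t n) := by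
    intro t ht n
    obtain ⟨ht1, -⟩ := Finset.mem_Icc.1 ht
    refine measurableSet_of_local (t := t)
      (fun s hs => hA.measurable_arm s (Finset.mem_Icc.1 hs).1)
      (p := fun a => a t = 0 ∧ IsCycleEndpoint a t ∧ cycleCount a 0 t = n) fun a a' h => ?_
    rw [h t (Finset.mem_Icc.2 ⟨ht1, le_rfl⟩), isCycleEndpoint_congr ht1 h, cycleCount_congr h]
  calc _ ≤ ∑ t ∈ Finset.Icc 1 T, ∫⁻ ω, ∑ n ∈ Finset.Icc 1 ⌊α * L + 1⌋₊,
        (if ω ∈ S t n then 1 else 0) * g n ω ∂P :=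
        Finset.sum_le_sum fun t ht => measure_explorationEvent_le hα hσ hασ hB hA hy
          (Finset.mem_Icc.1 ht).1 (Finset.mem_Icc.1 ht).2
    _ = ∫⁻ ω, ∑ t ∈ Finset.Icc 1 T, ∑ n ∈ Finset.Icc 1 ⌊α * L + 1⌋₊,
        (if ω ∈ S t n then 1 else 0) * g n ω ∂P := by
        rw [lintegral_finsetSum' _ fun t ht => ?_]
        refine Measurable.aemeasurable (Finset.measurable_sum _ fun n _ => ?_)
        exact (Measurable.ite (hSm t ht n) measurable_const measurable_const).mul (hgm n)
    _ ≤ ∫⁻ ω, ∑ n ∈ Finset.Icc 1 ⌊α * L + 1⌋₊, g n ω ∂P := by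
        refine lintegral_mono fun ω => ?_
        rw [Finset.sum_comm]
        refine Finset.sum_le_sum fun n _ => ?_
        rw [← Finset.sum_mul]
        refine mul_le_of_le_one_left' ?_
        have := card_cycleCount_eq_le_one (fun s => A s ω) 0 n T
        exact_mod_cast this
    _ = ∑ n ∈ Finset.Icc 1 ⌊α * L + 1⌋₊, ∫⁻ ω, g n ω ∂P := lintegral_finsetSum _ fun n _ => hgm n
    _ ≤ ∑ n ∈ Finset.Icc 1 ⌊α * L + 1⌋₊,
        ENNReal.ofReal (√(2 * Real.pi) * Real.exp 7 * deficitConst) := by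
        refine Finset.sum_le_sum fun n _ => ?_
        rw [lintegral_const_mul _ (measurable_deficitWeight hσ hB hA T n),
          ENNReal.ofReal_mul (p := √(2 * Real.pi) * Real.exp 7) (by positivity)]
        exact mul_le_mul_right (lintegral_deficitWeight_le hσ hB hA T n) _
    _ ≤ _ := by
        have h0 := deficitConst_nonneg
        have hL0 : 0 ≤ α * L + 1 := by positivity
        rw [Finset.sum_const, Nat.card_Icc, Nat.add_sub_cancel, nsmul_eq_mul,
          ← ENNReal.ofReal_natCast, ← ENNReal.ofReal_mul (by positivity)]
        exact ENNReal.ofReal_le_ofReal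
          (mul_le_mul_of_nonneg_right (Nat.floor_le hL0) (by positivity))

end Exploration

/-! ### Expected cycle counts of the suboptimal arms -/

section Samples

lemma sqrt_mul_sqrt_log_le {σ x k l : ℝ} (hx : 0 < x) (hk0 : 0 ≤ k)
    (hk : σ ^ 2 * l / x ^ 2 ≤ k) : √(σ ^ 2 / (1 + k)) * √l ≤ x := by
  rw [← Real.sqrt_mul (by positivity), Real.sqrt_le_left hx.le, div_mul_eq_mul_div,
    div_le_iff₀ (by positivity)]
  rw [div_le_iff₀ (by positivity)] at hk
  nlinarith [sq_nonneg x]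

lemma two_mul_sqrt_log_le_of_sample_gt {σ x k l S μ z : ℝ} (hx : 0 < x)
    (hk0 : 0 ≤ k) (hk : σ ^ 2 * l / x ^ 2 ≤ k) (hμ : 0 ≤ μ) (hS : S - μ * k ≤ x * k)
    (h : μ + 4 * x < S / (1 + k) + √(σ ^ 2 / (1 + k)) * z) : 2 * √l ≤ z := by
  have h1 := sqrt_mul_sqrt_log_le hx hk0 hk
  have h2 : S / (1 + k) ≤ μ + x := by
    rw [div_le_iff₀ (by positivity)]
    nlinarith
  by_contra hz
  have h3 := mul_le_mul_of_nonneg_left (not_le.1 hz).le (Real.sqrt_nonneg (σ ^ 2 / (1 + k)))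
  nlinarith

lemma le_neg_two_mul_sqrt_log_of_sample_le {σ x k l S μ z : ℝ} (hσ : 0 < σ) (hx : 0 < x)
    (hk0 : 0 ≤ k) (hk : σ ^ 2 * l / x ^ 2 ≤ k) (hxk : 1 / x ≤ k) (hμ : μ ≤ 1)
    (hS : μ * k - S ≤ x * k)
    (h : S / (1 + k) + √(σ ^ 2 / (1 + k)) * z ≤ μ - 4 * x) : z ≤ -(2 * √l) := by
  have h1 := sqrt_mul_sqrt_log_le hx hk0 hk
  have h2 : μ - 2 * x ≤ S / (1 + k) := by
    rw [le_div_iff₀ (by positivity)]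
    rw [div_le_iff₀ hx] at hxk
    nlinarith
  have hs : 0 < √(σ ^ 2 / (1 + k)) := Real.sqrt_pos.2 (by positivity)
  by_contra hz
  have h3 := mul_lt_mul_of_pos_left (not_le.1 hz) hs
  nlinarith

end Samples

section Expectation

variable {Ω : Type u} {K : ℕ} [NeZero K] {Y Z : Fin K → ℕ → Ω → ℝ} [mΩ : MeasurableSpace Ω]
  {P : Measure Ω} {A : ℕ → Ω → Fin K} {α σ x c μ : ℝ}

omit [NeZero K] mΩ in
lemma sub_le_of_exponent_lt {i : Fin K} {t : ℕ} {ω : Ω} (hx : 0 < x)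
    (hc : c ≤ 2 * x ^ 2 * cycleCount (fun s => A s ω) i t)
    (h : exponent μ (4 * x) Y A i t ω < c) :
    rewardSum (fun s => A s ω) (fun l s => Y l s ω) i t - μ * cycleCount (fun s => A s ω) i t ≤
      x * cycleCount (fun s => A s ω) i t := by
  rw [exponent] at h
  by_contra hcon
  have := mul_lt_mul_of_pos_left (not_le.1 hcon) (by linarith : 0 < 4 * x)
  nlinarith

omit [NeZero K] mΩ in
lemma sub_le_of_exponent_neg_lt {i : Fin K} {t : ℕ} {ω : Ω} (hx : 0 < x)
    (hc : c ≤ 2 * x ^ 2 * cycleCount (fun s => A s ω) i t)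
    (h : exponent μ (-(4 * x)) Y A i t ω < c) :
    μ * cycleCount (fun s => A s ω) i t - rewardSum (fun s => A s ω) (fun l s => Y l s ω) i t ≤
      x * cycleCount (fun s => A s ω) i t := by
  rw [exponent] at h
  by_contra hcon
  have := mul_lt_mul_of_pos_left (not_le.1 hcon) (by linarith : 0 < 4 * x)
  nlinarith

/-- The ways in which a suboptimal arm can be played at a counted step: it or the optimal arm has
few observations, or a rare deviation of the rewards or of the noise occurred. Here `x` is one
eighth of the gap, and `y` lies midway between the two means. -/
lemma counted_step_cases [IsProbabilityMeasure P] (hσ : 0 < σ) (hB : IsBandit P Y)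
    (hA : IsBatchedThompsonSampling P α σ Y Z A) {i : Fin K} {l L : ℝ}
    (hx : 0 < x) (hgap : gap P Y i = 8 * x) (hL : L = σ ^ 2 * l / x ^ 2)
    (hxL : 1 / x ≤ L) {t T : ℕ} (ht : 1 ≤ t) (htT : t ≤ T) {ω : Ω} (hAi : A t ω = i)
    (hend : IsCycleEndpoint (fun s => A s ω) t) :
    (cycleCount (fun s => A s ω) i (lastBatchEnd α (fun s => A s ω) t) : ℝ) < L ∨
    ((IsCycleEndpoint (fun s => A s ω) t ∧ ¬ IsBoundary (fun s => A s ω) (t - 1) ∧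
        A (t - 1) ω = 0) ∧
      (cycleCount (fun s => A s ω) 0 (lastBatchEnd α (fun s => A s ω) t) : ℝ) < L) ∨
    (∃ s ≤ T, 2 * σ ^ 2 * l ≤ exponent (meanReward P Y i) (4 * x) Y A i s ω) ∨
    2 * √l ≤ Z i t ω ∨
    (∃ s ≤ T, 2 * σ ^ 2 * l ≤ exponent (meanReward P Y 0) (-(4 * x)) Y A 0 s ω) ∨
    Z 0 t ω ≤ -(2 * √l) ∨
    ω ∈ explorationEvent α σ L (meanReward P Y 0 - 4 * x) Y Z A t := by
  by_contra! hcon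
  obtain ⟨h1, h2, h3, h4, h5, h6, h7⟩ := hcon
  set τ := lastBatchEnd α (fun s => A s ω) t with hτ
  have hτT : τ ≤ T := (lastBatchEnd_le α _ t).trans (by omega)
  have hmean : meanReward P Y 0 - 4 * x = meanReward P Y i + 4 * x := by
    rw [gap] at hgap; linarith
  have hcount : ∀ j, L ≤ (cycleCount (fun s => A s ω) j τ : ℝ) →
      2 * σ ^ 2 * l ≤ 2 * x ^ 2 * (cycleCount (fun s => A s ω) j τ : ℝ) := by
    intro j hj
    rw [hL, div_le_iff₀ (by positivity)] at hj
    linarith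
  have hi := (meanReward_mem_Icc hB i).1
  have h0 := (meanReward_mem_Icc hB 0).2
  -- the played arm, which has the largest sample, has a sample of at most `y`
  have hθi : theta α σ Y Z A i t ω ≤ meanReward P Y 0 - 4 * x := by
    by_contra hlt
    rw [not_le, hmean] at hlt
    exact absurd (two_mul_sqrt_log_le_of_sample_gt hx (by positivity) (hL ▸ h1) hi
      (sub_le_of_exponent_lt hx (hcount i h1) (h3 τ hτT)) hlt) (not_le.2 h4)
  have hmax : ∀ j, theta α σ Y Z A j t ω ≤ meanReward P Y 0 - 4 * x := fun j => by
    have : theta α σ Y Z A j t ω ≤ theta α σ Y Z A (A t ω) t ω := hA.arm_isMax ω t ht j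
    rw [hAi] at this
    exact this.trans hθi
  have hk0 : (cycleCount (fun s => A s ω) 0 τ : ℝ) < L := by
    by_contra hge
    rw [not_lt] at hge
    exact absurd (le_neg_two_mul_sqrt_log_of_sample_le hσ hx (by positivity) (hL ▸ hge)
      (hxL.trans hge) h0 (sub_le_of_exponent_neg_lt hx (hcount 0 hge) (h5 τ hτT)) (hmax 0))
      (not_le.2 h6)
  refine h7 ⟨?_, hk0, fun j _ => hmax j⟩
  by_contra hH
  rw [not_or, not_not] at hH
  exact absurd hk0 (not_lt.2 (h2 ⟨hend, hH.1, hH.2⟩))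

open Classical in
lemma cycleCount_le_sum_cases [IsProbabilityMeasure P] (hα : 1 < α) (hσ : 0 < σ)
    (hB : IsBandit P Y) (hA : IsBatchedThompsonSampling P α σ Y Z A) {i : Fin K} {l L : ℝ}
    (hx : 0 < x) (hgap : gap P Y i = 8 * x) (hl : 0 ≤ l) (hL : L = σ ^ 2 * l / x ^ 2)
    (hxL : 1 / x ≤ L) (T : ℕ) (ω : Ω) :
    (cycleCount (fun s => A s ω) i T : ENNReal) ≤ ENNReal.ofReal (2 * (α * L + 1)) +
      ∑ t ∈ Finset.Icc 1 T,
        ({ω | ∃ s ≤ T, 2 * σ ^ 2 * l ≤ exponent (meanReward P Y i) (4 * x) Y A i s ω}.indicator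
            1 ω +
          {ω | 2 * √l ≤ Z i t ω}.indicator 1 ω +
          {ω | ∃ s ≤ T, 2 * σ ^ 2 * l ≤ exponent (meanReward P Y 0) (-(4 * x)) Y A 0 s ω}.indicator
            1 ω +
          {ω | Z 0 t ω ≤ -(2 * √l)}.indicator 1 ω +
          (explorationEvent α σ L (meanReward P Y 0 - 4 * x) Y Z A t).indicator 1 ω) := by
  have hL0 : 0 ≤ L := by rw [hL]; positivity
  set a : ℕ → Fin K := fun s => A s ω with ha
  have hn1 := card_le_of_cycleCount_lt (a := a) hα hL0 i
    (p := fun t => a t = i ∧ IsCycleEndpoint a t) (fun t => le_rfl) T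
  have hn2 := card_le_of_cycleCount_lt (a := a) hα hL0 0
    (p := fun t => IsCycleEndpoint a t ∧ ¬ IsBoundary a (t - 1) ∧ a (t - 1) = 0)
    (fun t => (Nat.le_add_right _ _).trans (card_switch_le_cycleCount a 0 t)) T
  set n1 := ∑ t ∈ Finset.Icc 1 T, if (a t = i ∧ IsCycleEndpoint a t) ∧
    (cycleCount a i (lastBatchEnd α a t) : ℝ) < L then 1 else 0 with hn1d
  set n2 := ∑ t ∈ Finset.Icc 1 T, if (IsCycleEndpoint a t ∧ ¬ IsBoundary a (t - 1) ∧
    a (t - 1) = 0) ∧ (cycleCount a 0 (lastBatchEnd α a t) : ℝ) < L then 1 else 0 with hn2d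
  have hn : ((n1 + n2 : ℕ) : ENNReal) ≤ ENNReal.ofReal (2 * (α * L + 1)) := by
    rw [← ENNReal.ofReal_natCast]
    refine ENNReal.ofReal_le_ofReal ?_
    push_cast
    linarith
  refine le_trans ?_ (add_le_add hn le_rfl)
  rw [hn1d, hn2d, cycleCount]
  push_cast
  rw [← Finset.sum_add_distrib, ← Finset.sum_add_distrib]
  refine Finset.sum_le_sum fun t ht => ?_
  obtain ⟨ht1, htT⟩ := Finset.mem_Icc.1 ht
  by_cases he : a t = i ∧ IsCycleEndpoint a t
  · rw [if_pos he]
    simp only [he, true_and]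
    rcases counted_step_cases hσ hB hA hx hgap hL hxL ht1 htT he.1 he.2 with
      h | h | h | h | h | h | h
    · rw [if_pos h, add_assoc]; exact le_self_add
    · rw [if_pos (c := (¬ IsBoundary a (t - 1) ∧ a (t - 1) = 0) ∧
        (cycleCount a 0 (lastBatchEnd α a t) : ℝ) < L) ⟨h.1.2, h.2⟩, add_assoc]
      exact le_add_left le_self_add
    all_goals refine le_add_left ?_
    · rw [Set.indicator_of_mem (s := {ω | ∃ s ≤ T, 2 * σ ^ 2 * l ≤
        exponent (meanReward P Y i) (4 * x) Y A i s ω}) h, add_assoc, add_assoc, add_assoc]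
      exact le_self_add
    · rw [Set.indicator_of_mem (s := {ω | 2 * √l ≤ Z i t ω}) h]
      exact le_add_right (le_add_right (le_add_right (le_add_left le_rfl)))
    · rw [Set.indicator_of_mem (s := {ω | ∃ s ≤ T, 2 * σ ^ 2 * l ≤
        exponent (meanReward P Y 0) (-(4 * x)) Y A 0 s ω}) h]
      exact le_add_right (le_add_right (le_add_left le_rfl))
    · rw [Set.indicator_of_mem (s := {ω | Z 0 t ω ≤ -(2 * √l)}) h]
      exact le_add_right (le_add_left le_rfl)
    · rw [Set.indicator_of_mem h]
      exact le_add_left le_rfl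
  · rw [if_neg he]
    exact zero_le

/-- The constant of the bound for the expected cycle counts. -/
def countConst : ℝ := 128 * (6 + √(2 * Real.pi) * Real.exp 7 * deficitConst)

lemma countConst_pos : 0 < countConst := by
  have := deficitConst_nonneg
  unfold countConst
  positivity

lemma lintegral_cycleCount_le [IsProbabilityMeasure P] (hα : 1 < α) (hσ : 0 < σ)
    (hασ : α ≤ 5 * σ ^ 2 / 4) (hB : IsBandit P Y) (hA : IsBatchedThompsonSampling P α σ Y Z A)
    {i : Fin K} (hi : i ≠ 0) {T : ℕ} (hT : 2 ≤ T) :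
    ∫⁻ ω, (cycleCount (fun s => A s ω) i T : ENNReal) ∂P ≤
      ENNReal.ofReal (countConst * α * σ ^ 2 * (Real.log T / gap P Y i ^ 2)) := by
  set l := Real.log T with hldef
  set x := gap P Y i / 8 with hxdef
  set L := σ ^ 2 * l / x ^ 2 with hLdef
  have hgap0 := hB.gap_pos i hi
  have hgap1 : gap P Y i ≤ 1 := by
    have h1 := (meanReward_mem_Icc hB 0).2
    have h2 := (meanReward_mem_Icc hB i).1
    rw [gap]; linarith
  have hx : 0 < x := by positivity
  have hx1 : x ≤ 1 / 8 := by rw [hxdef]; linarith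
  have hT2 : (2 : ℝ) ≤ T := by exact_mod_cast hT
  have hT0 : (0 : ℝ) < T := by linarith
  have hl2 : 0.69 ≤ l := by
    have h1 := Real.log_le_log (by norm_num) hT2
    have h2 := Real.log_two_gt_d9
    linarith
  have hl : 0 ≤ l := by linarith
  have hσ2 : 4 / 5 ≤ σ ^ 2 := by linarith
  have hσl : (1 / 2 : ℝ) ≤ σ ^ 2 * l := by nlinarith
  have hxL : 1 / x ≤ L := by
    rw [hLdef, div_le_div_iff₀ hx (by positivity)]
    nlinarith
  have hL1 : 1 ≤ L := by
    refine le_trans ?_ hxL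
    rw [le_div_iff₀ hx]; linarith
  have hL0 : 0 ≤ L := by linarith
  have hαL : 1 ≤ α * L := by nlinarith
  have hgap : gap P Y i = 8 * x := by rw [hxdef]; ring
  -- each rare event has probability at most `1 / T`
  have hrare : ∀ c, l ≤ c → ENNReal.ofReal (Real.exp (-c)) ≤ ENNReal.ofReal (T : ℝ)⁻¹ := by
    intro c hc
    refine ENNReal.ofReal_le_ofReal ?_
    rw [← Real.exp_log (inv_pos.2 hT0), Real.log_inv]
    exact Real.exp_le_exp.2 (by linarith)
  have hD : ∀ j m, P {ω | ∃ s ≤ T, 2 * σ ^ 2 * l ≤ exponent (meanReward P Y j) m Y A j s ω} ≤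
      ENNReal.ofReal (T : ℝ)⁻¹ := fun j m =>
    (measure_exists_le_exponent hσ hB hA T _).trans (hrare _ (by nlinarith))
  have hsq : -(2 * √l) ^ 2 / 2 = -(2 * l) := by
    rw [mul_pow, Real.sq_sqrt hl]; ring
  have hN : ∀ t ∈ Finset.Icc 1 T, P {ω | 2 * √l ≤ Z i t ω} ≤ ENNReal.ofReal (T : ℝ)⁻¹ ∧
      P {ω | Z 0 t ω ≤ -(2 * √l)} ≤ ENNReal.ofReal (T : ℝ)⁻¹ := by
    intro t ht
    have ht1 := (Finset.mem_Icc.1 ht).1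
    have h1 := measure_le_gaussian (hA.measurable_noise i t ht1) (hA.map_noise i t ht1)
      (u := 2 * √l) (by positivity)
    have h2 := measure_le_neg_gaussian (hA.measurable_noise 0 t ht1) (hA.map_noise 0 t ht1)
      (u := 2 * √l) (by positivity)
    rw [hsq] at h1 h2
    exact ⟨h1.trans (hrare _ (by linarith)), h2.trans (hrare _ (by linarith))⟩
  have hmD : ∀ j m, MeasurableSet
      {ω | ∃ s ≤ T, 2 * σ ^ 2 * l ≤ exponent (meanReward P Y j) m Y A j s ω} := fun j m =>
    measurableSet_exists_le_exponent hσ hB hA T _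
  have hmZ1 : ∀ t ∈ Finset.Icc 1 T, MeasurableSet {ω | 2 * √l ≤ Z i t ω} := fun t ht =>
    measurableSet_le measurable_const (hA.measurable_noise i t (Finset.mem_Icc.1 ht).1)
  have hmZ0 : ∀ t ∈ Finset.Icc 1 T, MeasurableSet {ω | Z 0 t ω ≤ -(2 * √l)} := fun t ht =>
    measurableSet_le (hA.measurable_noise 0 t (Finset.mem_Icc.1 ht).1) measurable_const
  have hmE : ∀ t ∈ Finset.Icc 1 T,
      MeasurableSet (explorationEvent α σ L (meanReward P Y 0 - 4 * x) Y Z A t) := by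
    intro t ht
    obtain ⟨t, rfl⟩ := Nat.exists_eq_add_of_le' (Finset.mem_Icc.1 ht).1
    exact nullExtension_le _
      (measurableSet_explorationEvent_and_measurable_noiseThreshold hσ hB hA t).1
  have hexp := sum_measure_explorationEvent_le hα hσ hασ hB hA
    (y := meanReward P Y 0 - 4 * x) (by linarith) hL0 T
  calc _ ≤ _ := lintegral_mono fun ω => cycleCount_le_sum_cases hα hσ hB hA hx hgap hl hLdef hxL T ω
    _ = ENNReal.ofReal (2 * (α * L + 1)) + ∑ t ∈ Finset.Icc 1 T,
        (P {ω | ∃ s ≤ T, 2 * σ ^ 2 * l ≤ exponent (meanReward P Y i) (4 * x) Y A i s ω} +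
          P {ω | 2 * √l ≤ Z i t ω} +
          P {ω | ∃ s ≤ T, 2 * σ ^ 2 * l ≤ exponent (meanReward P Y 0) (-(4 * x)) Y A 0 s ω} +
          P {ω | Z 0 t ω ≤ -(2 * √l)} +
          P (explorationEvent α σ L (meanReward P Y 0 - 4 * x) Y Z A t)) := by
        rw [lintegral_add_left measurable_const, lintegral_const, measure_univ, mul_one,
          lintegral_finsetSum']
        · congr 1
          refine Finset.sum_congr rfl fun t ht => ?_
          rw [lintegral_add_right _ (measurable_one.indicator (hmE t ht)),
            lintegral_add_right _ (measurable_one.indicator (hmZ0 t ht)),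
            lintegral_add_right _ (measurable_one.indicator (hmD 0 (-(4 * x)))),
            lintegral_add_right _ (measurable_one.indicator (hmZ1 t ht)),
            lintegral_indicator_one (hmD _ _),
            lintegral_indicator_one (hmZ1 t ht), lintegral_indicator_one (hmD _ _),
            lintegral_indicator_one (hmZ0 t ht), lintegral_indicator_one (hmE t ht)]
        · intro t ht
          exact (((((measurable_one.indicator (hmD i (4 * x))).add
            (measurable_one.indicator (hmZ1 t ht))).add
            (measurable_one.indicator (hmD 0 (-(4 * x))))).add
            (measurable_one.indicator (hmZ0 t ht))).add
            (measurable_one.indicator (hmE t ht))).aemeasurable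
    _ ≤ ENNReal.ofReal (2 * (α * L + 1)) + (∑ t ∈ Finset.Icc 1 T, 4 * ENNReal.ofReal (T : ℝ)⁻¹ +
        ENNReal.ofReal ((α * L + 1) * (√(2 * Real.pi) * Real.exp 7 * deficitConst))) := by
        rw [Finset.sum_add_distrib]
        refine add_le_add le_rfl (add_le_add (Finset.sum_le_sum fun t ht => ?_) hexp)
        refine (add_le_add (add_le_add (add_le_add (hD i (4 * x)) (hN t ht).1) (hD 0 _))
          (hN t ht).2).trans (le_of_eq ?_)
        ring
    _ = ENNReal.ofReal (2 * (α * L + 1) + (4 +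
        (α * L + 1) * (√(2 * Real.pi) * Real.exp 7 * deficitConst))) := by
        have h0 := deficitConst_nonneg
        rw [ENNReal.ofReal_add (by positivity) (by positivity),
          ENNReal.ofReal_add (by positivity) (by positivity)]
        congr 2
        rw [Finset.sum_const, Nat.card_Icc, Nat.add_sub_cancel, nsmul_eq_mul,
          ← ENNReal.ofReal_natCast, mul_left_comm, ← ENNReal.ofReal_mul hT0.le,
          mul_inv_cancel₀ hT0.ne']
        simp
    _ ≤ _ := by
        refine ENNReal.ofReal_le_ofReal ?_
        have h0 : 0 ≤ √(2 * Real.pi) * Real.exp 7 * deficitConst :=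
          mul_nonneg (by positivity) deficitConst_nonneg
        have e : countConst * α * σ ^ 2 * (l / gap P Y i ^ 2) =
            2 * (6 + √(2 * Real.pi) * Real.exp 7 * deficitConst) * (α * L) := by
          rw [hLdef, hgap, countConst]
          field_simp
          ring
        rw [e]
        nlinarith
end Expectation

/-! ### Expected batch complexity -/

section BatchComplexity

variable {Ω : Type u} {K : ℕ} [NeZero K] {Y Z : Fin K → ℕ → Ω → ℝ} [MeasurableSpace Ω]
  {P : Measure Ω} [IsProbabilityMeasure P] {A : ℕ → Ω → Fin K} {α σ : ℝ} {T : ℕ}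

lemma integrable_batchIndex (hA : IsBatchedThompsonSampling P α σ Y Z A) (hT : 1 ≤ T) :
    Integrable (fun ω => (batchIndex α (fun t => A t ω) T : ℝ)) P := by
  have hm : Measurable fun ω => (batchIndex α (fun t => A t ω) T : ℝ) :=
    measurable_of_local (fun s hs => hA.measurable_arm s (Finset.mem_Icc.1 hs).1)
      (f := fun a => (batchIndex α a T : ℝ)) fun a a' h => by rw [batchIndex_congr hT h]
  refine Integrable.of_mem_Icc 0 T hm.aemeasurable (ae_of_all _ fun ω => ⟨by positivity, ?_⟩)
  have h1 := batchIndex_le_lastBatch_add_one (α := α) (a := fun t => A t ω) hT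
  have h2 := lastBatch_le α (fun t => A t ω) T
  exact_mod_cast (by omega : batchIndex α (fun t => A t ω) T ≤ T)

lemma integrable_cycleCount (hA : IsBatchedThompsonSampling P α σ Y Z A) (i : Fin K) (T : ℕ) :
    Integrable (fun ω => (cycleCount (fun t => A t ω) i T : ℝ)) P := by
  have hm : Measurable fun ω => (cycleCount (fun t => A t ω) i T : ℝ) :=
    measurable_of_local (fun s hs => hA.measurable_arm s (Finset.mem_Icc.1 hs).1)
      (f := fun a => (cycleCount a i T : ℝ)) fun a a' h => by rw [cycleCount_congr h]
  refine Integrable.of_mem_Icc 0 T hm.aemeasurable (ae_of_all _ fun ω => ⟨by positivity, ?_⟩)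
  exact_mod_cast (Finset.single_le_sum (f := fun i => cycleCount (fun t => A t ω) i T)
    (fun _ _ => Nat.zero_le _) (Finset.mem_univ i)).trans (sum_cycleCount_le T)

lemma integral_cycleCount_le (hα : 1 < α) (hσ : 0 < σ) (hασ : α ≤ 5 * σ ^ 2 / 4)
    (hB : IsBandit P Y) (hA : IsBatchedThompsonSampling P α σ Y Z A) (hT : 2 ≤ T) {i : Fin K}
    (hi : i ≠ 0) :
    ∫ ω, (cycleCount (fun t => A t ω) i T : ℝ) ∂P ≤
      countConst * α * σ ^ 2 * (Real.log T / gap P Y i ^ 2) := by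
  have h0 := countConst_pos
  have hlog : 0 ≤ Real.log T := Real.log_natCast_nonneg T
  rw [← ENNReal.ofReal_le_ofReal_iff (by positivity),
    ofReal_integral_eq_lintegral_ofReal (integrable_cycleCount hA i T)
      (ae_of_all _ fun ω => by positivity)]
  simp_rw [ENNReal.ofReal_natCast]
  exact lintegral_cycleCount_le hα hσ hασ hB hA hi hT

/-- The tangent of the concave function `x ↦ log_α (1 + x)` at `c`. -/
lemma logb_one_add_le (hα : 1 < α) {x c : ℝ} (hx : 0 ≤ x) (hc : 0 ≤ c) :
    Real.logb α (1 + x) ≤ Real.logb α (1 + c) + ((1 + c) * Real.log α)⁻¹ * (x - c) := by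
  have hlα : 0 < Real.log α := Real.log_pos hα
  have h := Real.log_le_sub_one_of_pos (div_pos (by linarith : 0 < 1 + x) (by linarith : 0 < 1 + c))
  rw [Real.log_div (by linarith) (by linarith)] at h
  have e : Real.logb α (1 + c) + ((1 + c) * Real.log α)⁻¹ * (x - c) =
      (Real.log (1 + c) + ((1 + x) / (1 + c) - 1)) / Real.log α := by
    rw [Real.logb]
    field_simp
    ring
  rw [e, Real.logb]
  gcongr
  linarith

lemma integral_batchIndex_le_logb (hα : 1 < α) (hσ : 0 < σ) (hασ : α ≤ 5 * σ ^ 2 / 4)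
    (hB : IsBandit P Y) (hA : IsBatchedThompsonSampling P α σ Y Z A) (hT : 2 ≤ T) :
    ∫ ω, (batchIndex α (fun t => A t ω) T : ℝ) ∂P ≤ 1 + K
      + Real.logb α (1 + countConst * α * σ ^ 2 *
          ∑ i ∈ Finset.univ.erase (0 : Fin K), Real.log T / gap P Y i ^ 2)
      + ∑ i ∈ Finset.univ.erase (0 : Fin K),
          Real.logb α (1 + countConst * α * σ ^ 2 * (Real.log T / gap P Y i ^ 2)) := by
  have h0 := countConst_pos
  have hlog : 0 ≤ Real.log T := Real.log_natCast_nonneg T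
  have hlα : 0 < Real.log α := Real.log_pos hα
  set I := Finset.univ.erase (0 : Fin K) with hI
  set c : Fin K → ℝ := fun i => countConst * α * σ ^ 2 * (Real.log T / gap P Y i ^ 2) with hcdef
  set M : Fin K → Ω → ℝ := fun i ω => (cycleCount (fun t => A t ω) i T : ℝ) with hM
  have hc : ∀ i, 0 ≤ c i := fun i => by positivity
  have hcs : 0 ≤ ∑ i ∈ I, c i := Finset.sum_nonneg fun i _ => hc i
  have hsum : countConst * α * σ ^ 2 * ∑ i ∈ I, Real.log T / gap P Y i ^ 2 = ∑ i ∈ I, c i :=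
    Finset.mul_sum _ _ _
  have hint : ∀ i, Integrable (M i) P := fun i => integrable_cycleCount hA i T
  have hle : ∀ i ∈ I, ∫ ω, (M i ω - c i) ∂P ≤ 0 := by
    intro i hi
    rw [integral_sub (hint i) (integrable_const _), integral_const, probReal_univ, one_smul]
    exact sub_nonpos.2 (integral_cycleCount_le hα hσ hασ hB hA hT (Finset.ne_of_mem_erase hi))
  set b : ℝ := ((1 + ∑ i ∈ I, c i) * Real.log α)⁻¹ with hb
  have hint1 : ∀ i, Integrable (fun ω => M i ω - c i) P := fun i =>
    (hint i).sub (integrable_const _)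
  have hint2 : Integrable (fun ω => ∑ i ∈ I, (((1 + c i) * Real.log α)⁻¹ + b) * (M i ω - c i)) P :=
    integrable_finsetSum _ fun i _ => (hint1 i).const_mul _
  have hpath : ∀ ω, (batchIndex α (fun t => A t ω) T : ℝ) ≤
      (1 + K + Real.logb α (1 + ∑ i ∈ I, c i) + ∑ i ∈ I, Real.logb α (1 + c i)) +
        ∑ i ∈ I, (((1 + c i) * Real.log α)⁻¹ + b) * (M i ω - c i) := by
    intro ω
    have h := batchIndex_le_sum_logb (a := fun t => A t ω) hα (by omega : 1 ≤ T)
    have hMnn : ∀ i, 0 ≤ M i ω := fun i => Nat.cast_nonneg _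
    have h1 := logb_one_add_le hα (Finset.sum_nonneg fun i _ => hMnn i : 0 ≤ ∑ i ∈ I, M i ω) hcs
    have h2 : ∑ i ∈ I, Real.logb α (1 + M i ω) ≤
        ∑ i ∈ I, (Real.logb α (1 + c i) + ((1 + c i) * Real.log α)⁻¹ * (M i ω - c i)) :=
      Finset.sum_le_sum fun i _ => logb_one_add_le hα (hMnn i) (hc i)
    rw [← Finset.sum_sub_distrib, Finset.mul_sum] at h1
    rw [Finset.sum_add_distrib] at h2
    have e : ∑ i ∈ I, (((1 + c i) * Real.log α)⁻¹ + b) * (M i ω - c i) =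
        ∑ i ∈ I, ((1 + c i) * Real.log α)⁻¹ * (M i ω - c i) + ∑ i ∈ I, b * (M i ω - c i) := by
      rw [← Finset.sum_add_distrib]
      exact Finset.sum_congr rfl fun i _ => add_mul _ _ _
    rw [e]
    linarith
  refine (integral_mono (integrable_batchIndex hA (by omega))
    ((integrable_const _).add hint2) hpath).trans ?_
  simp only [Pi.add_apply]
  rw [integral_add (integrable_const _) hint2, integral_const, probReal_univ, one_smul,
    integral_finsetSum _ fun i _ => (hint1 i).const_mul _, hsum]
  have hneg : ∑ i ∈ I, ∫ ω, (((1 + c i) * Real.log α)⁻¹ + b) * (M i ω - c i) ∂P ≤ 0 := by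
    refine Finset.sum_nonpos fun i hi => ?_
    rw [integral_const_mul]
    have := hc i
    exact mul_nonpos_of_nonneg_of_nonpos (by positivity) (hle i hi)
  linarith

lemma integral_batchIndex_le_sum (hα : 1 < α) (hσ : 0 < σ) (hασ : α ≤ 5 * σ ^ 2 / 4)
    (hB : IsBandit P Y) (hA : IsBatchedThompsonSampling P α σ Y Z A) (hT : 2 ≤ T) :
    ∫ ω, (batchIndex α (fun t => A t ω) T : ℝ) ∂P ≤ 1 + 2 * countConst * α * σ ^ 2 *
      ∑ i ∈ Finset.univ.erase (0 : Fin K), Real.log T / gap P Y i ^ 2 := by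
  have hint := integrable_finsetSum (Finset.univ.erase (0 : Fin K))
    fun i _ => integrable_cycleCount hA i T
  have hpath : ∀ ω, (batchIndex α (fun t => A t ω) T : ℝ) ≤
      1 + 2 * ∑ i ∈ Finset.univ.erase (0 : Fin K), (cycleCount (fun t => A t ω) i T : ℝ) := by
    intro ω
    exact_mod_cast batchIndex_le_sum (a := fun t => A t ω) hα (by omega : 1 ≤ T)
  refine (integral_mono (integrable_batchIndex hA (by omega))
    ((integrable_const _).add (hint.const_mul 2)) hpath).trans ?_
  simp only [Pi.add_apply]
  rw [integral_add (integrable_const _) (hint.const_mul 2), integral_const, probReal_univ, one_smul,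
    integral_const_mul, integral_finsetSum _ fun i _ => integrable_cycleCount hA i T]
  have h : ∑ i ∈ Finset.univ.erase (0 : Fin K), ∫ ω, (cycleCount (fun t => A t ω) i T : ℝ) ∂P ≤
      ∑ i ∈ Finset.univ.erase (0 : Fin K),
        countConst * α * σ ^ 2 * (Real.log T / gap P Y i ^ 2) :=
    Finset.sum_le_sum fun i hi =>
      integral_cycleCount_le hα hσ hασ hB hA hT (Finset.ne_of_mem_erase hi)
  rw [← Finset.mul_sum] at h
  linarith

/-- The explicit constant for the growth rate `K log log T` when all gaps are at least `δ`. -/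
def loglogConst (α σ δ : ℝ) : ℝ :=
  2 + (1 + 2 * (Real.log (1 + countConst * α * σ ^ 2 / δ ^ 2) + 1)) / Real.log α

lemma integral_batchIndex_le_loglog {δ : ℝ} (hα : 1 < α) (hσ : 0 < σ) (hασ : α ≤ 5 * σ ^ 2 / 4)
    (hδ : 0 < δ) (hB : IsBandit P Y) (hA : IsBatchedThompsonSampling P α σ Y Z A)
    (hgap : ∀ i, i ≠ 0 → δ ≤ gap P Y i) (hT : Real.exp (Real.exp 1) ≤ T) :
    ∫ ω, (batchIndex α (fun t => A t ω) T : ℝ) ∂P ≤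
      loglogConst α σ δ * (K * Real.log (Real.log T)) := by
  have h0 := countConst_pos
  have hlα : 0 < Real.log α := Real.log_pos hα
  have hT0 : (0 : ℝ) < T := (Real.exp_pos _).trans_le hT
  have hT2 : 2 ≤ T := by
    have h1 := Real.add_one_le_exp (1 : ℝ)
    have h2 := Real.add_one_le_exp (Real.exp 1)
    exact_mod_cast (by linarith : (2 : ℝ) ≤ T)
  have hl : Real.exp 1 ≤ Real.log T := (Real.le_log_iff_exp_le hT0).2 hT
  have hK : (1 : ℝ) ≤ K := by exact_mod_cast Nat.one_le_iff_ne_zero.2 (NeZero.ne K)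
  set l := Real.log T with hldef
  have hl1 : 1 ≤ l := (Real.one_le_exp zero_le_one).trans hl
  have hl0 : 0 < l := by linarith
  have hll : 1 ≤ Real.log l := (Real.le_log_iff_exp_le hl0).2 hl
  set R := countConst * α * σ ^ 2 / δ ^ 2 with hR
  have hR0 : 0 ≤ R := by positivity
  have hterm : ∀ i ∈ Finset.univ.erase (0 : Fin K), l / gap P Y i ^ 2 ≤ l / δ ^ 2 := by
    intro i hi
    have := hgap i (Finset.ne_of_mem_erase hi)
    gcongr
  have hcard : ((Finset.univ.erase (0 : Fin K)).card : ℝ) ≤ K := by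
    exact_mod_cast (Finset.card_erase_le).trans (by simp)
  have hsum : ∑ i ∈ Finset.univ.erase (0 : Fin K), l / gap P Y i ^ 2 ≤ K * (l / δ ^ 2) := by
    refine (Finset.sum_le_card_nsmul _ _ _ hterm).trans ?_
    rw [nsmul_eq_mul]
    gcongr
  have hB1 : Real.logb α (1 + R * l) ≤ (Real.log (1 + R) + 1) * Real.log l / Real.log α := by
    rw [Real.logb]
    have h1 : Real.log (1 + R * l) ≤ Real.log ((1 + R) * l) :=
      Real.log_le_log (by positivity) (by nlinarith)
    rw [Real.log_mul (by positivity) hl0.ne'] at h1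
    have h2 : 0 ≤ Real.log (1 + R) := Real.log_nonneg (by linarith)
    gcongr
    nlinarith
  have hA1 : Real.logb α (1 + countConst * α * σ ^ 2 *
      ∑ i ∈ Finset.univ.erase (0 : Fin K), l / gap P Y i ^ 2) ≤
      K / Real.log α + Real.logb α (1 + R * l) := by
    have h1 : 1 + countConst * α * σ ^ 2 *
        ∑ i ∈ Finset.univ.erase (0 : Fin K), l / gap P Y i ^ 2 ≤ K * (1 + R * l) := by
      have := mul_le_mul_of_nonneg_left hsum (by positivity : 0 ≤ countConst * α * σ ^ 2)
      have e : countConst * α * σ ^ 2 * (K * (l / δ ^ 2)) = K * (R * l) := by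
        rw [hR]; field_simp
      nlinarith
    have hpos : 0 ≤ ∑ i ∈ Finset.univ.erase (0 : Fin K), l / gap P Y i ^ 2 :=
      Finset.sum_nonneg fun i _ => by positivity
    have h2 := Real.logb_le_logb_of_le hα (by positivity) h1
    rw [Real.logb_mul (by positivity) (by positivity)] at h2
    refine h2.trans (add_le_add ?_ le_rfl)
    rw [Real.logb]
    gcongr
    exact (Real.log_le_sub_one_of_pos (by linarith)).trans (by linarith)
  have hnn : 0 ≤ Real.logb α (1 + R * l) :=
    Real.logb_nonneg hα (le_add_of_nonneg_right (by positivity))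
  have hC1 : ∑ i ∈ Finset.univ.erase (0 : Fin K),
      Real.logb α (1 + countConst * α * σ ^ 2 * (l / gap P Y i ^ 2)) ≤
      K * Real.logb α (1 + R * l) := by
    refine (Finset.sum_le_card_nsmul _ _ (Real.logb α (1 + R * l)) fun i hi => ?_).trans ?_
    · refine Real.logb_le_logb_of_le hα (by positivity) ?_
      have := mul_le_mul_of_nonneg_left (hterm i hi)
        (by positivity : 0 ≤ countConst * α * σ ^ 2)
      have e : countConst * α * σ ^ 2 * (l / δ ^ 2) = R * l := by rw [hR]; field_simp
      linarith
    · rw [nsmul_eq_mul]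
      exact mul_le_mul_of_nonneg_right hcard hnn
  refine (integral_batchIndex_le_logb hα hσ hασ hB hA hT2).trans ?_
  set B := (Real.log (1 + R) + 1) * Real.log l / Real.log α with hBdef
  have hB0 : 0 ≤ B := hnn.trans hB1
  have e : loglogConst α σ δ * (K * Real.log l) =
      2 * (K * Real.log l) + K / Real.log α * Real.log l + 2 * (K * B) := by
    rw [loglogConst, hBdef, ← hR]; field_simp; ring
  rw [e]
  have h1 : (K : ℝ) ≤ K * Real.log l := le_mul_of_one_le_right (by linarith) hll
  have h2 : K / Real.log α ≤ K / Real.log α * Real.log l :=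
    le_mul_of_one_le_right (by positivity) hll
  have h3 : B ≤ K * B := le_mul_of_one_le_left hB0 hK
  have h4 := mul_le_mul_of_nonneg_left hB1 (by linarith : (0 : ℝ) ≤ K)
  linarith

end BatchComplexity

end BatchedTS

end

theorem theorem2 :
    (∃ C : ℝ, 0 < C ∧
      ∀ {Ω : Type u} [MeasurableSpace Ω] (P : Measure Ω) [IsProbabilityMeasure P]
        (K : ℕ) [NeZero K] (α σ : ℝ) (Y Z : Fin K → ℕ → Ω → ℝ) (A : ℕ → Ω → Fin K) (T : ℕ),
        1 < α → 0 < σ → α ≤ 5 * σ ^ 2 / 4 → 2 ≤ T →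
        BatchedTS.IsBandit P Y → BatchedTS.IsBatchedThompsonSampling P α σ Y Z A →
        (K ≤ T → ∀ ω, (BatchedTS.batchIndex α (fun t => A t ω) T : ℝ) ≤
          1 + K + K * Real.logb α (T / K)) ∧
        Integrable (fun ω => (BatchedTS.batchIndex α (fun t => A t ω) T : ℝ)) P ∧
        (∫ ω, (BatchedTS.batchIndex α (fun t => A t ω) T : ℝ) ∂P) ≤
          1 + K
            + Real.logb α (1 + C * α * σ ^ 2 *
                ∑ i ∈ Finset.univ.erase (0 : Fin K), Real.log T / BatchedTS.gap P Y i ^ 2)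
            + ∑ i ∈ Finset.univ.erase (0 : Fin K),
                Real.logb α (1 + C * α * σ ^ 2 * (Real.log T / BatchedTS.gap P Y i ^ 2)) ∧
        (∫ ω, (BatchedTS.batchIndex α (fun t => A t ω) T : ℝ) ∂P) ≤
          1 + 2 * C * α * σ ^ 2 *
            ∑ i ∈ Finset.univ.erase (0 : Fin K), Real.log T / BatchedTS.gap P Y i ^ 2) ∧
    (∀ α σ δ : ℝ, 1 < α → 0 < σ → α ≤ 5 * σ ^ 2 / 4 → 0 < δ →
      ∃ (c : ℝ) (T₀ : ℕ),
        ∀ {Ω : Type u} [MeasurableSpace Ω] (P : Measure Ω) [IsProbabilityMeasure P]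
          (K : ℕ) [NeZero K] (Y Z : Fin K → ℕ → Ω → ℝ) (A : ℕ → Ω → Fin K) (T : ℕ),
          BatchedTS.IsBandit P Y → BatchedTS.IsBatchedThompsonSampling P α σ Y Z A →
          (∀ i, i ≠ 0 → δ ≤ BatchedTS.gap P Y i) → T₀ ≤ T →
          (∫ ω, (BatchedTS.batchIndex α (fun t => A t ω) T : ℝ) ∂P) ≤
            c * (K * Real.log (Real.log T))) := by
  refine ⟨⟨BatchedTS.countConst, BatchedTS.countConst_pos, ?_⟩, ?_⟩
  · intro Ω _ P _ K _ α σ Y Z A T hα hσ hασ hT hB hA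
    exact ⟨fun hKT ω => BatchedTS.batchIndex_le_of_le hα
        (Nat.one_le_iff_ne_zero.2 (NeZero.ne K)) hKT,
      BatchedTS.integrable_batchIndex hA (by omega),
      BatchedTS.integral_batchIndex_le_logb hα hσ hασ hB hA hT,
      BatchedTS.integral_batchIndex_le_sum hα hσ hασ hB hA hT⟩
  · intro α σ δ hα hσ hασ hδ
    refine ⟨BatchedTS.loglogConst α σ δ, ⌈Real.exp (Real.exp 1)⌉₊, ?_⟩
    intro Ω _ P _ K _ Y Z A T hB hA hgap hT
    exact BatchedTS.integral_batchIndex_le_loglog hα hσ hασ hδ hB hA hgap (Nat.ceil_le.1 hT)
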